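/- Let $\operatorname{sinc}(0)=1$ and $\operatorname{sinc}(x)=\sin(x)/x$ for $x\neq 0$. Consider the following values of $(m,M,K,J)$, for $m=1,\dots,20$: $$\begin{array}{rrrr} m & M & K & J \\ \hline 1 & 299 & 100 & 1 \\ 2 & 40248 & 100 & 1 \\ 3 & 6699356 & 1000 & 1 \\ 4 & 1199640415 & 1000 & 2 \\ 5 & 222209538173 & 1000 & 3 \\ 6 & 41928392459412 & 1000 & 3 \\ 7 & 8000791810720605 & 1000 & 4 \\ 8 & 1537961933686185453 & 1000 & 5 \\ 9 & 297136851932007766218 & 1000 & 6 \\ 10 & 57616626381701142703593 & 1000 & 7 \\ 11 & 11202463675353183172586907 & 1000 & 8 \\ 12 & 2182608774487516995740392959 & 1000 & 8 \\ 13 & 425930131275278060684396950683 & 1000 & 10 \\ 14 & 83225800344072649528263059652618 & 1000 & 10 \\ 15 & 16279019516889202909861702224716180 & 1000 & 11 \\ 16 & 3186898150182578894413446451622161442 & 1000 & 12 \\ 17 & 624331345650550634164994069452043597341 & 1000 & 13 \\ 18 & 122382651928233262387099042295616064808177 & 1000 & 14 \\ 19 & 24001760343280992647777613927571508451532532 &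 1000 & 15 \\ 20 & 4709265577657827035628502288018792360631413283 & 1000 & 16 \\ \end{array}$$ together with $m=100$, $K=50000$, $J=60$ and the 230-digit number $M$ whose decimal digits are (read line by line) $$\begin{aligned} &15930636153764656093549951961696713197434975028940 \\ &85877192998763567162101035983381719598376913882972 \\ &95285352168437589967676947222915769714257521188927 \\ &15116548003599042566741587106668007049302125094673 \\ &665769807765071841758755530945 \end{aligned}$$ For each of these 21 quadruples $(m,M,K,J)$ the following hold. 1. $M$ is the largest integer with $\displaystyle\sum_{k=0}^{M}\frac{1}{mk+1}<2\pi$. 2. This is certified by the Euler–Maclaurin formula with $J$ correction terms, applied to the tail after $K$ initial terms, in the following sense. We have $M\ge K$; put $n=M-K$ and $f(x)=1/(mx+Km+1)$. With $B_i$ the Bernoulli numbers, let $$A=\int_0^n f(x)\,dx+\tfrac12\bigl(f(0)+f(n)\bigr)+\sum_{j=1}^{J}\frac{B_{2j}}{(2j)!}\Bigl(f^{(2j-1)}(n)-f^{(2j-1)}(0)\Bigr),\qquad \rho(x)=\left|\frac{B_{2J+2}}{(2J+2)!}\,n\,f^{(2J+2)}(x)\right| .$$ Then $\bigl|\sum_{k=0}^{n}f(k)-A\bigr|\le\rho(x_0)$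 for some $x_0\in[0,n]$; moreover $\rho(x)\le\rho(0)$ for all $x\in[0,n]$; and, with $E=\sum_{k=0}^{K-1}\frac1{mk+1}+A$, $$E+\rho(0)<2\pi<E+\frac{1}{m(M+1)+1}-\rho(0).$$ 3. For every integer $N\ge 0$ the series and the (improper) integral in $$\frac12+\sum_{n=1}^{\infty}\prod_{k=0}^{N}\operatorname{sinc}\!\left(\frac{n}{mk+1}\right)=\int_0^\infty\prod_{k=0}^{N}\operatorname{sinc}\!\left(\frac{x}{mk+1}\right)dx$$ converge, and the equality holds if and only if $N\le M$. -/

import Mathlib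

open Filter Topology

/-- A row of the table: the modulus `m`, the cutoff `M`, the number `K` of initial terms that are
summed directly, and the number `J` of correction terms in the Euler-Maclaurin formula. -/
structure TableRow where
  m : ℕ
  M : ℕ
  K : ℕ
  J : ℕ

/-- The rows `m = 1, ..., 20` and the additional row `m = 100`. -/
def sincTable : List TableRow := [
  ⟨1, 299, 100, 1⟩,
  ⟨2, 40248, 100, 1⟩,
  ⟨3, 6699356, 1000, 1⟩,
  ⟨4, 1199640415, 1000, 2⟩,
  ⟨5, 222209538173, 1000, 3⟩,
  ⟨6, 41928392459412, 1000, 3⟩,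
  ⟨7, 8000791810720605, 1000, 4⟩,
  ⟨8, 1537961933686185453, 1000, 5⟩,
  ⟨9, 297136851932007766218, 1000, 6⟩,
  ⟨10, 57616626381701142703593, 1000, 7⟩,
  ⟨11, 11202463675353183172586907, 1000, 8⟩,
  ⟨12, 2182608774487516995740392959, 1000, 8⟩,
  ⟨13, 425930131275278060684396950683, 1000, 10⟩,
  ⟨14, 83225800344072649528263059652618, 1000, 10⟩,
  ⟨15, 16279019516889202909861702224716180, 1000, 11⟩,
  ⟨16, 3186898150182578894413446451622161442, 1000, 12⟩,
  ⟨17, 624331345650550634164994069452043597341, 1000, 13⟩,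
  ⟨18, 122382651928233262387099042295616064808177, 1000, 14⟩,
  ⟨19, 24001760343280992647777613927571508451532532, 1000, 15⟩,
  ⟨20, 4709265577657827035628502288018792360631413283, 1000, 16⟩,
  ⟨100, 15930636153764656093549951961696713197434975028940858771929987635671621010359833817195983769138829729528535216843758996767694722291576971425752118892715116548003599042566741587106668007049302125094673665769807765071841758755530945, 50000, 60⟩]

/-- The Euler-Maclaurin approximation, with `J` correction terms, to `∑_{k=0}^{n} f k`. -/
noncomputable def eulerMaclaurinApprox (J : ℕ) (f : ℝ → ℝ) (n : ℕ) : ℝ :=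
  (∫ x in (0 : ℝ)..(n : ℝ), f x) + (1 / 2) * (f 0 + f n) +
    ∑ j ∈ Finset.Icc 1 J, ((bernoulli (2 * j) : ℚ) : ℝ) / ((2 * j).factorial : ℝ) *
      (iteratedDeriv (2 * j - 1) f n - iteratedDeriv (2 * j - 1) f 0)

/-- The quantity `|B_{2J+2} / (2J+2)! * n * f^{(2J+2)}(x)|` that bounds, for a suitable
`x ∈ [0, n]`, the remainder of the Euler-Maclaurin formula. -/
noncomputable def eulerMaclaurinBound (J : ℕ) (f : ℝ → ℝ) (n : ℕ) (x : ℝ) : ℝ :=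
  |((bernoulli (2 * J + 2) : ℚ) : ℝ) / ((2 * J + 2).factorial : ℝ) * (n : ℝ) *
    iteratedDeriv (2 * J + 2) f x|

/-- The partial sum `∑_{k=0}^{N} 1 / (m k + 1)`. -/
noncomputable def apSum (m N : ℕ) : ℝ :=
  ∑ k ∈ Finset.range (N + 1), 1 / ((m : ℝ) * k + 1)

/-- The tail function `f(x) = 1 / (m x + K m + 1)`. -/
noncomputable def tailFun (m K : ℕ) (x : ℝ) : ℝ :=
  1 / ((m : ℝ) * x + (K : ℝ) * m + 1)

/-- The estimate of `∑_{k=0}^{K+n} 1 / (m k + 1)`: the first `K` terms are summed directly, and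
the Euler-Maclaurin approximation is applied to the remaining `n + 1` terms. -/
noncomputable def apEstimate (m K J n : ℕ) : ℝ :=
  (∑ k ∈ Finset.range K, 1 / ((m : ℝ) * k + 1)) + eulerMaclaurinApprox J (tailFun m K) n

/-- The Euler-Maclaurin estimate with `K` initial terms and `J` correction terms certifies that
`2π` lies strictly between the sums up to `k = K + n` and up to `k = K + n + 1`: the
remainder obeys the Euler-Maclaurin bound, the bound is largest at `x = 0`, and with this largest
value `ε` as error margin the estimate stays below `2π`, while after adding the next term it
exceeds `2π`. -/
def EulerMaclaurinCertifies (m K J n : ℕ) : Prop :=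
  (∃ x₀ ∈ Set.Icc (0 : ℝ) n,
    |(∑ k ∈ Finset.range (n + 1), tailFun m K k) - eulerMaclaurinApprox J (tailFun m K) n| ≤
      eulerMaclaurinBound J (tailFun m K) n x₀) ∧
  (∀ x ∈ Set.Icc (0 : ℝ) n,
    eulerMaclaurinBound J (tailFun m K) n x ≤ eulerMaclaurinBound J (tailFun m K) n 0) ∧
  apEstimate m K J n + eulerMaclaurinBound J (tailFun m K) n 0 < 2 * Real.pi ∧
  2 * Real.pi < apEstimate m K J n + 1 / ((m : ℝ) * (K + n + 1 : ℕ) + 1) -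
    eulerMaclaurinBound J (tailFun m K) n 0

/-- The product `∏_{k=0}^{N} sinc (a_k x)`. -/
noncomputable def sincProd (a : ℕ → ℝ) (N : ℕ) (x : ℝ) : ℝ :=
  ∏ k ∈ Finset.range (N + 1), Real.sinc (a k * x)

/-- `∑_{n=1}^{∞} ∏_{k=0}^{N} sinc (a_k n)` converges (as a limit of partial sums) to `S`. -/
def SincSeriesConverges (a : ℕ → ℝ) (N : ℕ) (S : ℝ) : Prop :=
  Tendsto (fun T : ℕ => ∑ n ∈ Finset.Icc 1 T, sincProd a N (n : ℝ)) atTop (𝓝 S)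

/-- `∫_0^∞ ∏_{k=0}^{N} sinc (a_k x) dx` converges (as an improper integral, which is needed for
`N = 0`) to `I`. -/
def SincIntegralConverges (a : ℕ → ℝ) (N : ℕ) (I : ℝ) : Prop :=
  Tendsto (fun T : ℝ => ∫ x in (0 : ℝ)..T, sincProd a N x) atTop (𝓝 I)

/-! The analytic half is a probabilistic aliasing argument. Take out the factor with `a 0 = 1`; the
remaining product of sincs is the characteristic function at `x` of a sum `X` of independent uniform
variables on `[-a k, a k]`. Since `sinc x * cos (x t)` is `(sin ((t+1) x) - sin ((t-1) x)) / (2 x)`,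
summing over integers gives differences of sawtooth waves at `X ± 1`, and integrating gives
differences of `π/2 * sign` there. Both limits pass under the expectation by dominated convergence
(`tendsto_sum_sinc_prod`, `tendsto_integral_sinc_prod`).

The sawtooth equals `π/2 * sign u - u/2` for `|u| < 2π`, and the linear parts account for the extra
`1/2`. The discrepancy between the two sides is therefore the expectation of a difference of
`aliasTerm`, which vanishes for `|u| < 2π` and is positive beyond `2π`. As `X` has full support in
`[-s, s]`, where `s` is the sum of the remaining `a k`, equality holds when `1 + s < 2π` and fails
when `1 + s > 2π`.

It remains to locate `2π` strictly between consecutive partial sums of `1/(mk+1)`. Euler–Maclaurin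
with an explicit remainder (`eulerMaclaurin_bound`) reduces this to numerical inequalities, which
are verified in integer fixed-point arithmetic with proved error bounds (`sincTable_rowCheck`).
Strictness on both sides rules out the borderline case of a sum equal to `2π`. -/

open scoped Nat

/-! ### Euler–Maclaurin summation with a sharp remainder bound -/

/-- Up to a positive factor, `(-1)^(p+1) * B_{2p}(x)` is the Fourier series `∑ cos (2πnx) / n^(2p)`,
whose terms are largest at `x = 0`. The constant sign of `B_{2p} - B_{2p}(x)` is what makes the
remainder bound sharp. -/
lemma bernoulli_even_sign (p : ℕ) (hp : p ≠ 0) :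
    0 ≤ (-1 : ℝ) ^ (p + 1) * (bernoulli (2 * p) : ℝ) ∧ ∀ x ∈ Set.Icc (0 : ℝ) 1,
      0 ≤ (-1 : ℝ) ^ (p + 1) * ((bernoulli (2 * p) : ℝ) - bernoulliFun (2 * p) x) := by
  have h0 := hasSum_one_div_nat_pow_mul_cos hp (x := 0) (by simp)
  have hc : (0 : ℝ) < (2 * Real.pi) ^ (2 * p) / 2 / (2 * p)! := by positivity
  have e0 := bernoulliFun_eval_zero (2 * p)
  unfold bernoulliFun at e0 ⊢
  rw [e0] at h0
  constructor
  · have := h0.nonneg fun n => by simp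
    refine nonneg_of_mul_nonneg_left (b := (2 * Real.pi) ^ (2 * p) / 2 / (2 * p)!) ?_ hc
    convert this using 1
    ring
  · intro x hx
    have h1 := hasSum_one_div_nat_pow_mul_cos hp hx
    have := (h0.sub h1).nonneg fun n => by
      simp only [mul_zero, Real.cos_zero]
      rw [← mul_sub]
      have := Real.cos_le_one (2 * Real.pi * n * x)
      exact mul_nonneg (by positivity) (by linarith)
    refine nonneg_of_mul_nonneg_left (b := (2 * Real.pi) ^ (2 * p) / 2 / (2 * p)!) ?_ hc
    convert this using 1
    ring

section EulerMaclaurin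

variable {g : ℕ → ℝ → ℝ}

lemma continuousOn_of_derivFamily
    (hg : ∀ i, ∀ x ∈ Set.Icc (0 : ℝ) 1, HasDerivAt (g i) (g (i + 1) x) x) (i : ℕ) :
    ContinuousOn (g i) (Set.uIcc (0 : ℝ) 1) := by
  rw [Set.uIcc_of_le zero_le_one]
  exact fun x hx => (hg i x hx).continuousAt.continuousWithinAt

lemma hasDerivAt_bernoulliFun_div_factorial (k : ℕ) (x : ℝ) :
    HasDerivAt (fun x => bernoulliFun (k + 1) x / ((k + 1)! : ℝ))
      (bernoulliFun k x / (k ! : ℝ)) x := by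
  refine ((hasDerivAt_bernoulliFun (k + 1) x).div_const ((k + 1)! : ℝ)).congr_deriv ?_
  rw [Nat.factorial_succ]
  push_cast
  field_simp

lemma integral_bernoulliFun_mul_deriv
    (hg : ∀ i, ∀ x ∈ Set.Icc (0 : ℝ) 1, HasDerivAt (g i) (g (i + 1) x) x) (k i : ℕ) :
    ∫ x in (0 : ℝ)..1, bernoulliFun k x / (k ! : ℝ) * g i x =
      bernoulliFun (k + 1) 1 / ((k + 1)! : ℝ) * g i 1
        - bernoulliFun (k + 1) 0 / ((k + 1)! : ℝ) * g i 0
        - ∫ x in (0 : ℝ)..1, bernoulliFun (k + 1) x / ((k + 1)! : ℝ) * g (i + 1) x := by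
  have hB : ∀ k, Continuous fun x => bernoulliFun k x / (k ! : ℝ) := fun k =>
    (continuous_bernoulliFun k).div_const _
  have := intervalIntegral.integral_mul_deriv_eq_deriv_mul (a := 0) (b := 1)
    (u := fun x => bernoulliFun (k + 1) x / ((k + 1)! : ℝ)) (v := g i)
    (u' := fun x => bernoulliFun k x / (k ! : ℝ)) (v' := g (i + 1))
    (fun x _ => hasDerivAt_bernoulliFun_div_factorial k x)
    (fun x hx => hg i x (by rwa [Set.uIcc_of_le zero_le_one] at hx))
    ((hB k).intervalIntegrable _ _)
    (continuousOn_of_derivFamily hg (i + 1)).intervalIntegrable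
  linarith

lemma integral_bernoulliFun_mul_deriv'
    (hg : ∀ i, ∀ x ∈ Set.Icc (0 : ℝ) 1, HasDerivAt (g i) (g (i + 1) x) x) {k : ℕ} (hk : k ≠ 0) :
    ∫ x in (0 : ℝ)..1, bernoulliFun k x / (k ! : ℝ) * g k x =
      (bernoulli (k + 1) : ℝ) / ((k + 1)! : ℝ) * (g k 1 - g k 0)
        - ∫ x in (0 : ℝ)..1, bernoulliFun (k + 1) x / ((k + 1)! : ℝ) * g (k + 1) x := by
  rw [integral_bernoulliFun_mul_deriv hg, bernoulliFun_endpoints_eq_of_ne_one (by omega),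
    bernoulliFun_eval_zero]
  ring

/-- Repeated integration by parts against `B_k(x)/k!`. Each induction step integrates twice, and the
boundary term of odd index drops out because `B_{2J+3} = 0`. The base case uses `B_1(0) = -1/2` and
`B_1(1) = 1/2`. -/
lemma eulerMaclaurin_unit
    (hg : ∀ i, ∀ x ∈ Set.Icc (0 : ℝ) 1, HasDerivAt (g i) (g (i + 1) x) x) (J : ℕ) :
    1 / 2 * (g 0 0 + g 0 1) - ∫ x in (0 : ℝ)..1, g 0 x =
      ∑ j ∈ Finset.Icc 1 J, (bernoulli (2 * j) : ℝ) / ((2 * j)! : ℝ) *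
        (g (2 * j - 1) 1 - g (2 * j - 1) 0) +
      ∫ x in (0 : ℝ)..1, bernoulliFun (2 * J + 1) x / ((2 * J + 1)! : ℝ) * g (2 * J + 1) x := by
  induction J with
  | zero =>
    have := integral_bernoulliFun_mul_deriv hg 0 0
    simp only [bernoulliFun_zero, zero_add, bernoulliFun_one] at this
    simp only [Nat.factorial, Nat.cast_one, div_one, one_mul] at this
    simp [bernoulliFun_one]
    norm_num at this
    linarith
  | succ J ih =>
    rw [ih, Finset.sum_Icc_succ_top (by omega), integral_bernoulliFun_mul_deriv' hg (by omega),
      integral_bernoulliFun_mul_deriv' hg (k := 2 * J + 1 + 1) (by omega),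
      bernoulli_eq_zero_of_odd (n := 2 * J + 1 + 1 + 1) ⟨J + 1, by ring⟩ (by omega)]
    rw [show 2 * (J + 1) - 1 = 2 * J + 1 by omega, show 2 * (J + 1) = 2 * J + 1 + 1 by ring]
    simp
    ring

/-- One more integration by parts, with the boundary term rewritten as an integral, turns the
remainder into the integral of `(B_{2J+2} - B_{2J+2}(x))/(2J+2)!` against `g (2J+2)`. This weight
has constant sign and, since `B_{2J+2}(x)` has mean zero, its integral is exactly
`B_{2J+2}/(2J+2)!`; no constant is lost. -/
lemma eulerMaclaurin_unit_bound
    (hg : ∀ i, ∀ x ∈ Set.Icc (0 : ℝ) 1, HasDerivAt (g i) (g (i + 1) x) x) (J : ℕ) {C : ℝ}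
    (hC : ∀ x ∈ Set.Icc (0 : ℝ) 1, |g (2 * J + 2) x| ≤ C) :
    |1 / 2 * (g 0 0 + g 0 1) - (∫ x in (0 : ℝ)..1, g 0 x) -
      ∑ j ∈ Finset.Icc 1 J, (bernoulli (2 * j) : ℝ) / ((2 * j)! : ℝ) *
        (g (2 * j - 1) 1 - g (2 * j - 1) 0)| ≤
      |(bernoulli (2 * J + 2) : ℝ) / ((2 * J + 2)! : ℝ)| * C := by
  rw [eulerMaclaurin_unit hg J, add_sub_cancel_left, integral_bernoulliFun_mul_deriv' hg (by omega)]
  have hcont := continuousOn_of_derivFamily hg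
  have hint : g (2 * J + 1) 1 - g (2 * J + 1) 0 = ∫ x in (0 : ℝ)..1, g (2 * J + 1 + 1) x := by
    refine (intervalIntegral.integral_eq_sub_of_hasDerivAt (fun x hx => hg _ x ?_)
      (hcont _).intervalIntegrable).symm
    rwa [Set.uIcc_of_le zero_le_one] at hx
  have hBc : Continuous fun x => bernoulliFun (2 * J + 1 + 1) x / ((2 * J + 1 + 1)! : ℝ) :=
    (continuous_bernoulliFun _).div_const _
  have hBg : IntervalIntegrable (fun x => bernoulliFun (2 * J + 1 + 1) x /
      ((2 * J + 1 + 1)! : ℝ) * g (2 * J + 1 + 1) x) MeasureTheory.volume 0 1 :=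
    (hBc.continuousOn.mul (hcont _)).intervalIntegrable
  rw [hint, ← intervalIntegral.integral_const_mul, ← intervalIntegral.integral_sub
    ((hcont _).intervalIntegrable.const_mul _) hBg]
  set σ : ℝ := (-1) ^ (J + 1 + 1)
  have hσ : |σ| = 1 := by simp [σ]
  have hs := bernoulli_even_sign (J + 1) (by omega)
  have habs : ∀ t : ℝ, 0 ≤ σ * t → |t| = σ * t := fun t ht => by
    rw [← abs_of_nonneg ht, abs_mul, hσ, one_mul]
  set F : ℝ := ((2 * J + 1 + 1)! : ℝ)
  have hF : 0 < F := by positivity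
  have key : ∀ x ∈ Set.Icc (0 : ℝ) 1,
      |(bernoulli (2 * J + 1 + 1) : ℝ) - bernoulliFun (2 * J + 1 + 1) x| =
      σ * ((bernoulli (2 * J + 1 + 1) : ℝ) - bernoulliFun (2 * J + 1 + 1) x) := fun x hx =>
    habs _ (hs.2 x hx)
  have hB0 : |(bernoulli (2 * J + 1 + 1) : ℝ)| = σ * (bernoulli (2 * J + 1 + 1) : ℝ) :=
    habs _ hs.1
  rw [← Real.norm_eq_abs]
  calc _ ≤ ∫ x in (0 : ℝ)..1, σ * ((bernoulli (2 * J + 1 + 1) : ℝ) -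
          bernoulliFun (2 * J + 1 + 1) x) / F * C := by
        refine intervalIntegral.norm_integral_le_of_norm_le zero_le_one
          (Eventually.of_forall fun x hx => ?_) (Continuous.intervalIntegrable ?_ _ _)
        · have hx' : x ∈ Set.Icc (0 : ℝ) 1 := ⟨hx.1.le, hx.2⟩
          rw [← key x hx', ← sub_mul, ← sub_div, norm_mul, norm_div, Real.norm_eq_abs,
            Real.norm_eq_abs, Real.norm_eq_abs, abs_of_pos hF]
          gcongr
          exact hC x hx'
        · have := continuous_bernoulliFun (2 * J + 1 + 1)
          fun_prop
    _ = _ := by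
        rw [intervalIntegral.integral_mul_const, intervalIntegral.integral_div,
          intervalIntegral.integral_const_mul, intervalIntegral.integral_sub
          (by simp) ((continuous_bernoulliFun _).intervalIntegrable _ _),
          integral_bernoulliFun_eq_zero (by omega), abs_div, abs_of_pos hF, hB0]
        simp

lemma eulerMaclaurin_bound {f : ℝ → ℝ}
    (hf : ∀ i, ∀ x : ℝ, 0 ≤ x → DifferentiableAt ℝ (iteratedDeriv i f) x) (J n : ℕ) {C : ℝ}
    (hC : ∀ x : ℝ, 0 ≤ x → |iteratedDeriv (2 * J + 2) f x| ≤ C) :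
    |(∑ k ∈ Finset.range (n + 1), f k) - eulerMaclaurinApprox J f n| ≤
      |(bernoulli (2 * J + 2) : ℝ) / ((2 * J + 2)! : ℝ)| * n * C := by
  have hunit : ∀ a : ℕ, |1 / 2 * (f a + f (a + 1 : ℕ)) - (∫ x in (a : ℝ)..(a + 1 : ℕ), f x) -
      ∑ j ∈ Finset.Icc 1 J, (bernoulli (2 * j) : ℝ) / ((2 * j)! : ℝ) *
        (iteratedDeriv (2 * j - 1) f (a + 1 : ℕ) - iteratedDeriv (2 * j - 1) f a)| ≤
      |(bernoulli (2 * J + 2) : ℝ) / ((2 * J + 2)! : ℝ)| * C := by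
    intro a
    have := eulerMaclaurin_unit_bound (g := fun i x => iteratedDeriv i f (x + a))
      (fun i x hx => by
        have h1 := (hf i (x + a) (add_nonneg hx.1 a.cast_nonneg)).hasDerivAt
        rw [← iteratedDeriv_succ] at h1
        exact h1.comp_add_const x a) J (C := C)
      (fun x hx => hC _ (add_nonneg hx.1 a.cast_nonneg))
    simpa [intervalIntegral.integral_comp_add_right (fun x => f x), add_comm] using this
  have hcont : ∀ a b : ℕ, IntervalIntegrable f MeasureTheory.volume a b := fun a b => by
    refine ContinuousOn.intervalIntegrable fun x hx => ?_
    have hx0 : 0 ≤ x := le_trans (by simp) hx.1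
    simpa using (hf 0 x hx0).continuousAt.continuousWithinAt
  have hsum : (∑ k ∈ Finset.range (n + 1), f k) - eulerMaclaurinApprox J f n =
      ∑ a ∈ Finset.range n, (1 / 2 * (f a + f (a + 1 : ℕ)) - (∫ x in (a : ℝ)..(a + 1 : ℕ), f x) -
      ∑ j ∈ Finset.Icc 1 J, (bernoulli (2 * j) : ℝ) / ((2 * j)! : ℝ) *
        (iteratedDeriv (2 * j - 1) f (a + 1 : ℕ) - iteratedDeriv (2 * j - 1) f a)) := by
    rw [Finset.sum_sub_distrib, Finset.sum_sub_distrib, Finset.sum_comm,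
      intervalIntegral.sum_integral_adjacent_intervals (a := fun k : ℕ => (k : ℝ))
        (fun k _ => hcont k (k + 1))]
    have h1 : ∀ (u : ℝ → ℝ), ∑ a ∈ Finset.range n, (u (a + 1 : ℕ) - u a) = u n - u 0 := fun u => by
      simpa using Finset.sum_range_sub (fun k : ℕ => u k) n
    have h2 : ∑ a ∈ Finset.range n, 1 / 2 * (f a + f (a + 1 : ℕ)) =
        ∑ k ∈ Finset.range (n + 1), f k - 1 / 2 * (f 0 + f n) := by
      rw [← Finset.mul_sum, Finset.sum_add_distrib]
      have e1 := Finset.sum_range_succ (fun k : ℕ => f k) n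
      have e2 := Finset.sum_range_succ' (fun k : ℕ => f k) n
      simp only [Nat.cast_zero] at e2
      linarith
    rw [h2, eulerMaclaurinApprox]
    simp_rw [← Finset.mul_sum, h1]
    simp
    ring
  rw [hsum]
  refine (Finset.abs_sum_le_sum_abs _ _).trans ((Finset.sum_le_sum fun a _ => hunit a).trans ?_)
  simp
  apply le_of_eq
  ring

end EulerMaclaurin

/-! ### Euler–Maclaurin for the tail of the series -/

lemma iteratedDeriv_tailFun (m K i : ℕ) (x : ℝ) :
    iteratedDeriv i (tailFun m K) x =
      (-1) ^ i * (i ! : ℝ) * (m : ℝ) ^ i * ((m : ℝ) * x + (K * m + 1)) ^ (-1 - i : ℤ) := by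
  have : tailFun m K = fun x => ((m : ℝ) * x + (K * m + 1))⁻¹ := by
    ext x; rw [tailFun, one_div, add_assoc]
  rw [this, iteratedDeriv_eq_iterate, iter_deriv_inv_linear]

lemma iteratedDeriv_tailFun' (m K i : ℕ) (x : ℝ) :
    iteratedDeriv i (tailFun m K) x =
      (-1) ^ i * (i ! : ℝ) * (m : ℝ) ^ i / ((m : ℝ) * x + (K * m + 1)) ^ (i + 1) := by
  rw [iteratedDeriv_tailFun, show (-1 - i : ℤ) = -((i + 1 : ℕ) : ℤ) by push_cast; ring, zpow_neg,
    zpow_natCast, div_eq_mul_inv]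

lemma differentiableAt_iteratedDeriv_tailFun (m K i : ℕ) {x : ℝ} (hx : 0 ≤ x) :
    DifferentiableAt ℝ (iteratedDeriv i (tailFun m K)) x := by
  rw [funext (iteratedDeriv_tailFun' m K i)]
  have : ((m : ℝ) * x + (K * m + 1)) ^ (i + 1) ≠ 0 := by positivity
  fun_prop (disch := assumption)

lemma abs_iteratedDeriv_tailFun_le (m K i : ℕ) {x : ℝ} (hx : 0 ≤ x) :
    |iteratedDeriv i (tailFun m K) x| ≤ |iteratedDeriv i (tailFun m K) 0| := by
  simp only [iteratedDeriv_tailFun', abs_div, abs_mul, abs_pow]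
  rw [abs_of_pos (show 0 < (m : ℝ) * x + (K * m + 1) by positivity),
    abs_of_pos (show 0 < (m : ℝ) * 0 + (K * m + 1) by positivity)]
  gcongr

lemma eulerMaclaurinBound_tailFun_le (m K J n : ℕ) {x : ℝ} (hx : 0 ≤ x) :
    eulerMaclaurinBound J (tailFun m K) n x ≤ eulerMaclaurinBound J (tailFun m K) n 0 := by
  unfold eulerMaclaurinBound
  rw [abs_mul, abs_mul _ (iteratedDeriv _ _ 0)]
  exact mul_le_mul_of_nonneg_left (abs_iteratedDeriv_tailFun_le m K _ hx) (abs_nonneg _)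

lemma eulerMaclaurin_tailFun (m K J n : ℕ) :
    |(∑ k ∈ Finset.range (n + 1), tailFun m K k) - eulerMaclaurinApprox J (tailFun m K) n| ≤
      eulerMaclaurinBound J (tailFun m K) n 0 := by
  refine (eulerMaclaurin_bound (fun i x hx => differentiableAt_iteratedDeriv_tailFun m K i hx) J n
    (fun x hx => abs_iteratedDeriv_tailFun_le m K _ hx)).trans (le_of_eq ?_)
  rw [eulerMaclaurinBound, abs_mul, abs_mul _ (n : ℝ), Nat.abs_cast]

lemma apSum_eq_add_tail (m K n : ℕ) : apSum m (K + n) =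
    (∑ k ∈ Finset.range K, 1 / ((m : ℝ) * k + 1)) + ∑ k ∈ Finset.range (n + 1), tailFun m K k := by
  rw [apSum, add_assoc, Finset.sum_range_add]
  congr 1
  refine Finset.sum_congr rfl fun k _ => ?_
  rw [tailFun]
  push_cast
  congr 1
  ring

lemma abs_apSum_sub_apEstimate_le (m K J n : ℕ) :
    |apSum m (K + n) - apEstimate m K J n| ≤ eulerMaclaurinBound J (tailFun m K) n 0 := by
  rw [apSum_eq_add_tail, apEstimate, add_sub_add_left_eq_sub]
  exact eulerMaclaurin_tailFun m K J n

lemma apSum_succ (m N : ℕ) :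
    apSum m (N + 1) = apSum m N + 1 / ((m : ℝ) * (N + 1 : ℕ) + 1) :=
  Finset.sum_range_succ _ _

lemma apSum_mono (m : ℕ) : Monotone (apSum m) :=
  monotone_nat_of_le_succ fun N => by
    rw [apSum_succ]
    exact le_add_of_nonneg_right (by positivity)

/-- The witness `x₀ = 0` suffices: the derivatives of `tailFun` are largest in absolute value at the
left end, so the supremum bound is the bound at `0`. -/
lemma eulerMaclaurinCertifies_of_bounds {m K J n : ℕ}
    (h1 : apEstimate m K J n + eulerMaclaurinBound J (tailFun m K) n 0 < 2 * Real.pi)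
    (h2 : 2 * Real.pi < apEstimate m K J n + 1 / ((m : ℝ) * (K + n + 1 : ℕ) + 1) -
      eulerMaclaurinBound J (tailFun m K) n 0) :
    EulerMaclaurinCertifies m K J n :=
  ⟨⟨0, by simp, eulerMaclaurin_tailFun m K J n⟩,
    fun _ hx => eulerMaclaurinBound_tailFun_le m K J n hx.1, h1, h2⟩

lemma EulerMaclaurinCertifies.apSum_lt {m K J n : ℕ} (h : EulerMaclaurinCertifies m K J n) :
    apSum m (K + n) < 2 * Real.pi := by
  have := (abs_le.1 (abs_apSum_sub_apEstimate_le m K J n)).2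
  linarith [h.2.2.1]

lemma EulerMaclaurinCertifies.lt_apSum {m K J n : ℕ} (h : EulerMaclaurinCertifies m K J n) :
    2 * Real.pi < apSum m (K + n + 1) := by
  have := (abs_le.1 (abs_apSum_sub_apEstimate_le m K J n)).1
  rw [apSum_succ]
  linarith [h.2.2.2]

/-! ### Fixed-point arithmetic with error bounds -/

/-- The scale of the fixed-point arithmetic. -/
def fixedScale : ℕ := 10 ^ 250

/-- The integer `v` is a fixed-point approximation of `x` with error at most `e` units. -/
def FixedApprox (x : ℝ) (v e : ℤ) : Prop := |(fixedScale : ℝ) * x - v| ≤ e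

lemma fixedScale_pos : (0 : ℝ) < fixedScale := by
  rw [fixedScale]; positivity

namespace FixedApprox

variable {x y : ℝ} {v w d e : ℤ}

lemma add (hx : FixedApprox x v d) (hy : FixedApprox y w e) :
    FixedApprox (x + y) (v + w) (d + e) := by
  unfold FixedApprox at *
  push_cast
  rw [abs_le] at *
  constructor <;> linarith [hx.1, hx.2, hy.1, hy.2]

lemma intCast_mul (hx : FixedApprox x v e) (k : ℤ) : FixedApprox (k * x) (k * v) (|k| * e) := by
  unfold FixedApprox at *
  push_cast
  rw [show (fixedScale : ℝ) * (k * x) - k * v = k * (fixedScale * x - v) by ring, abs_mul]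
  gcongr

lemma abs_sub_ediv_le (p : ℤ) {q : ℤ} (hq : 0 < q) : |(p : ℝ) / q - (p / q : ℤ)| ≤ 1 := by
  have hq' : (0 : ℝ) < q := by exact_mod_cast hq
  have h1 : (p : ℝ) = q * (p / q : ℤ) + (p % q : ℤ) := by
    exact_mod_cast (Int.mul_ediv_add_emod p q).symm
  have h2 : (0 : ℝ) ≤ (p % q : ℤ) := by exact_mod_cast Int.emod_nonneg p hq.ne'
  have h3 : ((p % q : ℤ) : ℝ) < q := by exact_mod_cast Int.emod_lt_of_pos p hq
  have h4 : (p : ℝ) / q - (p / q : ℤ) = (p % q : ℤ) / q := by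
    rw [div_sub' hq'.ne', h1]
    congr 1
    ring
  rw [h4, abs_of_nonneg (by positivity), div_le_one hq']
  exact h3.le

lemma div_int (hx : FixedApprox x v e) {q : ℤ} (hq : 1 ≤ q) :
    FixedApprox (x / q) (v / q) (e + 1) := by
  unfold FixedApprox at *
  have hq' : (1 : ℝ) ≤ q := by exact_mod_cast hq
  have h1 := abs_sub_ediv_le v (q := q) (by omega)
  have h2 : |(fixedScale * x - v) / q| ≤ e := by
    rw [abs_div, abs_of_pos (by linarith : (0 : ℝ) < q)]
    exact (div_le_self (abs_nonneg _) hq').trans hx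
  calc _ = |(fixedScale * x - v) / q + ((v : ℝ) / q - (v / q : ℤ))| := by
        congr 1; ring
    _ ≤ _ := by push_cast; exact (abs_add_le _ _).trans (add_le_add h2 h1)

lemma ratio (p : ℤ) {q : ℤ} (hq : 0 < q) :
    FixedApprox ((p : ℝ) / q) (fixedScale * p / q) 1 := by
  unfold FixedApprox
  have := abs_sub_ediv_le (fixedScale * p) hq
  push_cast at this ⊢
  rwa [← mul_div_assoc]

lemma lt_of_lt (hx : FixedApprox x v d) (hy : FixedApprox y w e) (h : v + d < w - e) : x < y := by
  unfold FixedApprox at *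
  rw [abs_le] at *
  have : (v : ℝ) + d < w - e := by exact_mod_cast h
  refine lt_of_mul_lt_mul_left ?_ fixedScale_pos.le
  linarith [hx.2, hy.1]

end FixedApprox

/-! ### Fixed-point values of arctangents, logarithms and `2π` -/

/-- The first `n` terms of `∑ s ^ i * x ^ (2 * (k + i) + 1) / (2 * (k + i) + 1)`, where `x = p / q`
and `t` approximates `x ^ (2 * k + 1)`. -/
def oddSeries (s : ℤ) (p q : ℕ) : ℕ → ℕ → ℕ → ℤ
  | 0, _, _ => 0
  | n + 1, k, t => (t / (2 * k + 1) : ℕ) + s * oddSeries s p q n (k + 1) (t * p ^ 2 / q ^ 2)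

lemma abs_sub_natDiv_le (p : ℕ) {q : ℕ} (hq : 0 < q) : |(p : ℝ) / q - (p / q : ℕ)| ≤ 1 := by
  have := FixedApprox.abs_sub_ediv_le (p : ℤ) (q := (q : ℤ)) (by exact_mod_cast hq)
  rwa [← Int.natCast_ediv, Int.cast_natCast, Int.cast_natCast, Int.cast_natCast] at this

/-- With `x ≤ 1/3` the error of the running power stays at most 2 units: each step multiplies it by
`x^2 ≤ 1/9` and adds at most 1 for rounding. Dividing by `2k+1` costs one more unit, hence 3 per
term. -/
lemma oddSeries_approx {s : ℤ} (hs : |s| = 1) {p q : ℕ} (hq : 0 < q) (hpq : 3 * p ≤ q) (n : ℕ) :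
    ∀ k t : ℕ, |(fixedScale : ℝ) * (p / q : ℝ) ^ (2 * k + 1) - t| ≤ 2 →
      |(fixedScale : ℝ) * ∑ i ∈ Finset.range n,
        (s : ℝ) ^ i * (p / q : ℝ) ^ (2 * (k + i) + 1) / (2 * (k + i : ℕ) + 1) -
          oddSeries s p q n k t| ≤ 3 * n := by
  have hq' : (0 : ℝ) < q := by exact_mod_cast hq
  have hx0 : (0 : ℝ) ≤ p / q := by positivity
  have hx1 : (p / q : ℝ) ≤ 1 / 3 := by
    rw [div_le_div_iff₀ hq' (by norm_num)]
    have : (3 * p : ℝ) ≤ q := by exact_mod_cast hpq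
    linarith
  have hs' : |(s : ℝ)| = 1 := by exact_mod_cast hs
  induction n with
  | zero => intro k t _; simp [oddSeries]
  | succ n ih =>
    intro k t ht
    have hstep : |(fixedScale : ℝ) * (p / q : ℝ) ^ (2 * (k + 1) + 1) -
        (t * p ^ 2 / q ^ 2 : ℕ)| ≤ 2 := by
      have h1 := abs_sub_natDiv_le (t * p ^ 2) (q := q ^ 2) (by positivity)
      have h2 : |(p / q : ℝ) ^ 2 * (fixedScale * (p / q : ℝ) ^ (2 * k + 1) - t)| ≤ 1 := by
        rw [abs_mul, abs_of_nonneg (by positivity)]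
        calc (p / q : ℝ) ^ 2 * _ ≤ (1 / 3) ^ 2 * 2 := by gcongr
          _ ≤ 1 := by norm_num
      calc _ = |(p / q : ℝ) ^ 2 * (fixedScale * (p / q : ℝ) ^ (2 * k + 1) - t) +
            (((t * p ^ 2 : ℕ) : ℝ) / ((q ^ 2 : ℕ) : ℝ) - (t * p ^ 2 / q ^ 2 : ℕ))| := by
            congr 1
            push_cast
            ring
        _ ≤ 2 := (abs_add_le _ _).trans (by linarith)
    have hrest := ih (k + 1) _ hstep
    have hfirst : |(fixedScale : ℝ) * ((p / q : ℝ) ^ (2 * k + 1) / (2 * k + 1)) -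
        (t / (2 * k + 1) : ℕ)| ≤ 3 := by
      have h1 := abs_sub_natDiv_le t (q := 2 * k + 1) (by positivity)
      have h2 : |(fixedScale * (p / q : ℝ) ^ (2 * k + 1) - t) / (2 * k + 1)| ≤ 2 := by
        rw [abs_div, abs_of_pos (by positivity : (0 : ℝ) < 2 * k + 1)]
        refine (div_le_self (abs_nonneg _) ?_).trans ht
        have : (0 : ℝ) ≤ k := by positivity
        linarith
      calc _ = |(fixedScale * (p / q : ℝ) ^ (2 * k + 1) - t) / (2 * k + 1) +
            ((t : ℝ) / ((2 * k + 1 : ℕ) : ℝ) - (t / (2 * k + 1) : ℕ))| := by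
            congr 1
            push_cast
            ring
        _ ≤ 3 := (abs_add_le _ _).trans (by linarith)
    rw [Finset.sum_range_succ', oddSeries]
    set R : ℤ := oddSeries s p q n (k + 1) (t * p ^ 2 / q ^ 2)
    set T : ℝ := ∑ i ∈ Finset.range n,
        (s : ℝ) ^ i * (p / q : ℝ) ^ (2 * (k + 1 + i) + 1) / (2 * (k + 1 + i : ℕ) + 1) with hT
    have hsum : ∑ i ∈ Finset.range n, (s : ℝ) ^ (i + 1) * (p / q : ℝ) ^ (2 * (k + (i + 1)) + 1) /
        (2 * (k + (i + 1) : ℕ) + 1) = s * T := by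
      rw [hT, Finset.mul_sum]
      refine Finset.sum_congr rfl fun i _ => ?_
      rw [show k + (i + 1) = k + 1 + i by ring]
      ring
    rw [hsum]
    calc _ = |((fixedScale : ℝ) * ((p / q : ℝ) ^ (2 * k + 1) / (2 * k + 1)) -
          (t / (2 * k + 1) : ℕ)) + s * (fixedScale * T - R)| := by
          congr 1
          simp only [Int.cast_add, Int.cast_mul, Int.cast_natCast, pow_zero, add_zero]
          ring
      _ ≤ 3 + 3 * n := by
          refine (abs_add_le _ _).trans (add_le_add hfirst ?_)
          rw [abs_mul, hs', one_mul]
          exact hrest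
      _ = _ := by push_cast; ring

/-- Fixed-point approximation of `∑ s ^ i * x ^ (2 * i + 1) / (2 * i + 1)` for `x = p / q ≤ 1/3`. -/
def oddSeriesApprox (s : ℤ) (p q : ℕ) : ℤ := oddSeries s p q 265 0 (fixedScale * p / q)

set_option exponentiation.threshold 600 in
lemma fixedApprox_oddSeries {s : ℤ} (hs : |s| = 1) {p q : ℕ} (hq : 0 < q) (hpq : 3 * p ≤ q) {L : ℝ}
    (hL : HasSum (fun i : ℕ => (s : ℝ) ^ i * (p / q : ℝ) ^ (2 * i + 1) / (2 * i + 1)) L) :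
    FixedApprox L (oddSeriesApprox s p q) 796 := by
  have hq' : (0 : ℝ) < q := by exact_mod_cast hq
  have hx0 : (0 : ℝ) ≤ p / q := by positivity
  have hx1 : (p / q : ℝ) ≤ 1 / 3 := by
    rw [div_le_div_iff₀ hq' (by norm_num)]
    have : (3 * p : ℝ) ≤ q := by exact_mod_cast hpq
    linarith
  have hs' : |(s : ℝ)| = 1 := by exact_mod_cast hs
  have h1 := oddSeries_approx hs hq hpq 265 0 (fixedScale * p / q) (by
    have := abs_sub_natDiv_le (fixedScale * p) hq
    push_cast at this
    rw [mul_zero, zero_add, pow_one, ← mul_div_assoc]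
    exact this.trans (by norm_num))
  -- The truncation error is dominated by a geometric series of ratio `(1/3)^2`. As `3^531` exceeds
  -- `10^250 * 9/8`, it is below one unit, so the total error is `1 + 3 * 265 = 796`.
  have htail : ‖L - ∑ i ∈ Finset.range 265,
      (s : ℝ) ^ i * (p / q : ℝ) ^ (2 * i + 1) / (2 * i + 1)‖ ≤
      (1 / 3) ^ 531 * (1 - 1 / 9)⁻¹ := by
    refine ((hasSum_nat_add_iff' 265).2 hL).norm_le_of_bounded
      ((hasSum_geometric_of_lt_one (r := 1 / 9) (by norm_num) (by norm_num)).mul_left _)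
      fun i => ?_
    rw [norm_div, norm_mul, norm_pow, norm_pow, Real.norm_eq_abs, hs', one_pow, one_mul,
      Real.norm_of_nonneg hx0, Real.norm_of_nonneg (by positivity)]
    calc _ ≤ (p / q : ℝ) ^ (2 * (i + 265) + 1) := div_le_self (by positivity) (by
          have : (0 : ℝ) ≤ (i + 265 : ℕ) := by positivity
          linarith)
      _ ≤ (1 / 3) ^ (2 * (i + 265) + 1) := by gcongr
      _ = _ := by
          rw [show 2 * (i + 265) + 1 = 531 + 2 * i by ring, pow_add, pow_mul]
          norm_num
  unfold FixedApprox oddSeriesApprox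
  simp only [zero_add] at h1
  set T := ∑ i ∈ Finset.range 265, (s : ℝ) ^ i * (p / q : ℝ) ^ (2 * i + 1) / (2 * i + 1)
  calc _ ≤ |(fixedScale : ℝ) * (L - T)| + |(fixedScale : ℝ) * T - oddSeries s p q 265 0 (fixedScale * p / q)| := by
        refine le_trans (le_of_eq ?_) (abs_add_le _ _)
        congr 1; ring
    _ ≤ 1 + 3 * (265 : ℕ) := by
        refine add_le_add ?_ h1
        rw [abs_mul, abs_of_pos fixedScale_pos]
        refine (mul_le_mul_of_nonneg_left htail fixedScale_pos.le).trans ?_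
        rw [fixedScale]
        norm_num
    _ = _ := by norm_num

/-- Fixed-point approximation of `2π`, from Machin's formula. -/
def twoPiApprox : ℤ := 32 * oddSeriesApprox (-1) 1 5 + -8 * oddSeriesApprox (-1) 1 239

lemma fixedApprox_two_pi : FixedApprox (2 * Real.pi) twoPiApprox 31840 := by
  have h : ∀ q : ℕ, 3 ≤ q → FixedApprox (Real.arctan (q : ℝ)⁻¹) (oddSeriesApprox (-1) 1 q) 796 := by
    intro q hq
    have hq' : (3 : ℝ) ≤ q := by exact_mod_cast hq
    refine fixedApprox_oddSeries (by norm_num) (by omega) (by omega) ?_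
    have := Real.hasSum_arctan (x := (q : ℝ)⁻¹) (by
      rw [norm_inv, RCLike.norm_natCast]
      exact inv_lt_one_of_one_lt₀ (by linarith))
    simpa using this
  have := ((h 5 (by norm_num)).intCast_mul 32).add ((h 239 (by norm_num)).intCast_mul (-8))
  rw [show |(32 : ℤ)| * 796 + |-8| * 796 = 31840 by norm_num] at this
  rw [← twoPiApprox] at this
  convert this using 1
  have := Real.four_mul_arctan_inv_5_sub_arctan_inv_239
  push_cast
  linarith

/-- This is `log ((q+p)/(q-p)) = 2 artanh (p/q)`. -/
lemma fixedApprox_log {p q : ℕ} (hq : 0 < q) (hpq : 3 * p ≤ q) :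
    FixedApprox (Real.log (q + p) - Real.log (q - p)) (2 * oddSeriesApprox 1 p q) 1592 := by
  have hq' : (0 : ℝ) < q := by exact_mod_cast hq
  have hpq' : (3 * p : ℝ) ≤ q := by exact_mod_cast hpq
  have hp : (0 : ℝ) ≤ p := by positivity
  have hx : |(p / q : ℝ)| < 1 := by
    rw [abs_of_nonneg (by positivity), div_lt_one hq']
    linarith
  have h1 : HasSum (fun i : ℕ => ((1 : ℤ) : ℝ) ^ i * (p / q : ℝ) ^ (2 * i + 1) / (2 * i + 1))
      (1 / 2 * (Real.log (1 + p / q) - Real.log (1 - p / q))) := by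
    have h := (Real.hasSum_log_sub_log_of_abs_lt_one hx).mul_left (1 / 2)
    have e : (fun i : ℕ => 1 / 2 * (2 * (1 / (2 * (i : ℝ) + 1)) * (p / q : ℝ) ^ (2 * i + 1))) =
        fun i : ℕ => ((1 : ℤ) : ℝ) ^ i * (p / q : ℝ) ^ (2 * i + 1) / (2 * i + 1) := by
      ext i
      rw [Int.cast_one, one_pow]
      ring
    rwa [e] at h
  have h2 := fixedApprox_oddSeries (s := 1) (by norm_num) hq hpq h1
  convert h2.intCast_mul 2 using 1
  swap
  · norm_num
  rw [show (1 + (p / q : ℝ)) = (q + p) / q by field_simp,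
    show (1 - (p / q : ℝ)) = (q - p) / q by field_simp,
    Real.log_div (by positivity) hq'.ne', Real.log_div (by linarith) hq'.ne']
  push_cast
  ring

/-- Fixed-point approximation of `log (a / c)` for `c * 2 ^ e ≤ a ≤ c * 2 ^ (e + 1)`, as the sum of
`log (a / (c * 2 ^ e))` and `e * log 2`. -/
def logRatioApprox (a c e : ℕ) : ℤ :=
  2 * oddSeriesApprox 1 (a - c * 2 ^ e) (a + c * 2 ^ e) + e * (2 * oddSeriesApprox 1 1 3)

/-- Removing the power of 2 leaves a ratio `a/b` in `[1, 2]`, where `b = c * 2^e`; then `(a-b)/(a+b)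
≤ 1/3`, the range where the series applies. The value `1/3` itself yields `log 2`. -/
lemma fixedApprox_logRatio {a c e : ℕ} (hc : 0 < c) (h1 : c * 2 ^ e ≤ a)
    (h2 : a ≤ 2 * (c * 2 ^ e)) :
    FixedApprox (Real.log a - Real.log c) (logRatioApprox a c e) (1592 * (e + 1)) := by
  have hc' : (0 : ℝ) < c := by exact_mod_cast hc
  have hb : 0 < c * 2 ^ e := by positivity
  have ha : (0 : ℝ) < a := by exact_mod_cast hb.trans_le h1
  have l2 : FixedApprox (Real.log 2) (2 * oddSeriesApprox 1 1 3) 1592 := by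
    convert fixedApprox_log (p := 1) (q := 3) (by norm_num) (by norm_num) using 1
    push_cast
    rw [← Real.log_div (by norm_num) (by norm_num)]
    norm_num
  have l1 := fixedApprox_log (p := a - c * 2 ^ e) (q := a + c * 2 ^ e) (by omega) (by omega)
  have := l1.add (l2.intCast_mul e)
  unfold logRatioApprox
  convert this using 1
  · push_cast [h1]
    rw [show (a : ℝ) + c * 2 ^ e + (a - c * 2 ^ e) = 2 * a by ring,
      show (a : ℝ) + c * 2 ^ e - (a - c * 2 ^ e) = 2 * (c * 2 ^ e) by ring,
      Real.log_mul (by norm_num) ha.ne', Real.log_mul (by norm_num) (by positivity),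
      Real.log_mul (by positivity) (by positivity), Real.log_pow]
    ring
  · rw [abs_of_nonneg (by positivity)]
    ring

/-! ### Fixed-point sums of reciprocals -/

/-- The sum of `fixedScale / (m * i + 1)` over the `i < K` in `[a * 2 ^ d, (a + 1) * 2 ^ d)`. -/
def reciprocalSum (m K : ℕ) : ℕ → ℕ → ℕ
  | 0, a => bif Nat.blt a K then fixedScale / (m * a + 1) else 0
  | d + 1, a => reciprocalSum m K d (2 * a) + reciprocalSum m K d (2 * a + 1)

/-- The recursion halves the index block at each level, so its depth is `d` instead of the number of
terms; indices beyond `K` contribute zero. -/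
lemma reciprocalSum_eq (m K d : ℕ) : ∀ a, reciprocalSum m K d a =
    ∑ i ∈ Finset.range (2 ^ d), if a * 2 ^ d + i < K then
      fixedScale / (m * (a * 2 ^ d + i) + 1) else 0 := by
  induction d with
  | zero =>
    intro a
    simp [reciprocalSum, cond_eq_ite, Nat.blt_eq]
  | succ d ih =>
    intro a
    rw [reciprocalSum, ih, ih, pow_succ, mul_two, Finset.sum_range_add]
    congr 1 <;> refine Finset.sum_congr rfl fun i _ => ?_
    · rw [show 2 * a * 2 ^ d + i = a * (2 ^ d + 2 ^ d) + i by ring]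
    · rw [show (2 * a + 1) * 2 ^ d + i = a * (2 ^ d + 2 ^ d) + (2 ^ d + i) by ring]

lemma fixedApprox_reciprocalSum {m K d : ℕ} (hK : K ≤ 2 ^ d) :
    FixedApprox (∑ k ∈ Finset.range K, 1 / ((m : ℝ) * k + 1)) (reciprocalSum m K d 0) K := by
  have : reciprocalSum m K d 0 = ∑ k ∈ Finset.range K, fixedScale / (m * k + 1) := by
    rw [reciprocalSum_eq, ← Finset.sum_filter]
    simp only [zero_mul, zero_add]
    refine Finset.sum_congr ?_ fun _ _ => rfl
    ext i
    simp only [Finset.mem_filter, Finset.mem_range]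
    omega
  rw [this]
  unfold FixedApprox
  push_cast
  rw [Finset.mul_sum, ← Finset.sum_sub_distrib]
  refine (Finset.abs_sum_le_sum_abs _ _).trans ((Finset.sum_le_sum fun k _ => ?_).trans
    (b := ∑ k ∈ Finset.range K, (1 : ℝ)) (by simp))
  have := abs_sub_natDiv_le fixedScale (q := m * k + 1) (by positivity)
  push_cast at this
  rwa [mul_one_div]

/-! ### Bernoulli numbers in integer arithmetic -/

/-- `∑ N.choose (k + i) * l[i]`, where `c = N.choose k`. -/
def chooseDot (N : ℕ) : ℕ → ℕ → List ℤ → ℤ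
  | _, _, [] => 0
  | k, c, b :: l => c * b + chooseDot N (k + 1) (c * (N - k) / (k + 1)) l

/-- The list `D * B_n, ..., D * B_0`, or `none` if one of these is not an integer. -/
def bernoulliList (D : ℤ) : ℕ → Option (List ℤ)
  | 0 => some [D]
  | n + 1 =>
    match bernoulliList D n with
    | none => none
    | some l =>
      let t := chooseDot (n + 2) 2 ((n + 2) * (n + 1) / 2) l
      if t % (n + 2) = 0 then some (-(t / (n + 2)) :: l) else none

/-- The list `D * B_n, ..., D * B_0` of rational numbers. -/
noncomputable def scaledBernoulliList (D : ℤ) : ℕ → List ℚ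
  | 0 => [D * bernoulli 0]
  | n + 1 => D * bernoulli (n + 1) :: scaledBernoulliList D n

lemma chooseDot_eq {N : ℕ} {D : ℤ} {n : ℕ} : ∀ {k : ℕ} {l : List ℤ},
    l.map (fun z : ℤ => (z : ℚ)) = scaledBernoulliList D n →
      (chooseDot N k (N.choose k) l : ℚ) =
        ∑ i ∈ Finset.range (n + 1), N.choose (k + i) * (D * bernoulli (n - i)) := by
  have hc : ∀ k, N.choose k * (N - k) / (k + 1) = N.choose (k + 1) := fun k => by
    rw [← Nat.choose_succ_right_eq, Nat.mul_div_cancel _ (by omega)]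
  induction n with
  | zero =>
    intro k l hl
    match l with
    | [b] =>
      simp only [scaledBernoulliList, List.map_cons, List.map_nil, List.cons.injEq] at hl
      simp [chooseDot, hl.1]
    | [] => simp [scaledBernoulliList] at hl
    | _ :: _ :: _ => simp [scaledBernoulliList] at hl
  | succ n ih =>
    intro k l hl
    match l with
    | [] => simp [scaledBernoulliList] at hl
    | b :: l =>
      simp only [scaledBernoulliList, List.map_cons, List.cons.injEq] at hl
      have := ih (k := k + 1) hl.2
      rw [Finset.sum_range_succ', chooseDot, hc]
      push_cast
      rw [this, hl.1, add_comm]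
      simp only [add_zero]
      congr 1
      refine Finset.sum_congr rfl fun i _ => ?_
      rw [show k + 1 + i = k + (i + 1) by ring]

/-- The recurrence is `∑_{k ≤ n+1} (n+2).choose k * B_k = 0`, solved for `B_{n+1}`, whose
coefficient is `n+2`. Integrality of the scaled values is tested during the computation, so no
theorem on denominators of Bernoulli numbers is used. -/
lemma bernoulliList_spec {D : ℤ} {n : ℕ} : ∀ {l : List ℤ}, bernoulliList D n = some l →
    l.map (fun z : ℤ => (z : ℚ)) = scaledBernoulliList D n := by
  induction n with
  | zero =>
    intro l hl
    simp only [bernoulliList, Option.some.injEq] at hl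
    simp [scaledBernoulliList, ← hl]
  | succ n ih =>
    intro l' hl'
    rw [bernoulliList] at hl'
    match hl : bernoulliList D n with
    | none => simp [hl] at hl'
    | some l =>
      have h2 := ih hl
      simp only [hl] at hl'
      have hchoose : (n + 2).choose 2 = (n + 2) * (n + 1) / 2 := by
        rw [Nat.choose_two_right]; rfl
      rw [← hchoose] at hl'
      have hdot := chooseDot_eq (N := n + 2) (k := 2) h2
      set t : ℤ := chooseDot (n + 2) 2 ((n + 2).choose 2) l
      split_ifs at hl' with hmod
      have hdvd : ((n : ℤ) + 2) * (t / (n + 2)) = t :=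
        Int.mul_ediv_cancel' (Int.dvd_of_emod_eq_zero hmod)
      have hdvd' : ((n : ℚ) + 2) * ((t / (n + 2) : ℤ) : ℚ) = t := by exact_mod_cast hdvd
      rw [Option.some.injEq] at hl'
      rw [← hl', List.map_cons, h2, scaledBernoulliList]
      congr 1
      have hsum := sum_bernoulli (n + 2)
      -- Reversing the sum matches the list, which starts at `B_n`; the symmetry `(n+2).choose (n-j)
      -- = (n+2).choose (2+j)` explains why `chooseDot` starts at `k = 2`.
      rw [if_neg (by omega), Finset.sum_range_succ, ← Finset.sum_range_reflect] at hsum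
      have hcoef : ((n + 2).choose (n + 1) : ℚ) = n + 2 := by
        rw [show n + 2 = n + 1 + 1 by ring, Nat.choose_succ_self_right]
        push_cast
        ring
      have ht : (t : ℚ) = D * ∑ j ∈ Finset.range (n + 1),
          ((n + 2).choose (n + 1 - 1 - j) : ℚ) * bernoulli (n + 1 - 1 - j) := by
        rw [hdot, Finset.mul_sum]
        refine Finset.sum_congr rfl fun j hj => ?_
        rw [Finset.mem_range] at hj
        rw [show n + 1 - 1 - j = n - j by omega,
          Nat.choose_symm_of_eq_add (show n + 2 = 2 + j + (n - j) by omega)]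
        ring
      rw [hcoef] at hsum
      have hn : (n : ℚ) + 2 ≠ 0 := by positivity
      apply mul_left_cancel₀ hn
      push_cast
      linear_combination (-(1 : ℚ)) * hdvd' - ht - D * hsum

lemma scaledBernoulliList_getD (D : ℤ) (n k : ℕ) (hk : k ≤ n) :
    (scaledBernoulliList D n).getD (n - k) 0 = D * bernoulli k := by
  induction n with
  | zero =>
    obtain rfl : k = 0 := by omega
    simp [scaledBernoulliList]
  | succ n ih =>
    rw [scaledBernoulliList]
    rcases Nat.eq_or_lt_of_le hk with rfl | h
    · simp
    · rw [show n + 1 - k = (n - k) + 1 by omega, List.getD_cons_succ, ih (by omega)]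

lemma bernoulliList_getD {D : ℤ} {n : ℕ} {l : List ℤ} (hl : bernoulliList D n = some l)
    {k : ℕ} (hk : k ≤ n) : (l.getD (n - k) 0 : ℝ) = D * (bernoulli k : ℝ) := by
  have h := scaledBernoulliList_getD D n k hk
  rw [← bernoulliList_spec hl, ← Int.cast_zero, List.getD_map] at h
  exact_mod_cast h

/-- A common denominator of the Bernoulli numbers up to `B_123`: the product of the primes up to
`123`. -/
def bernoulliDenom : ℤ :=
  2 * 3 * 5 * 7 * 11 * 13 * 17 * 19 * 23 * 29 * 31 * 37 * 41 * 43 * 47 * 53 * 59 * 61 * 67 * 71 *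
    73 * 79 * 83 * 89 * 97 * 101 * 103 * 107 * 109 * 113

/-! ### The estimate in closed form and the numerical certificate -/

/-- With `a = m(K+n)+1` and `c = mK+1`, the integral is `log (a/c) / m`. In the corrections
`(2j+1)!` cancels against `(2j+2)!`, and the difference of inverse powers is put over `(ac)^(2j+2)`
so that a single integer division evaluates each term. -/
lemma apEstimate_eq (m K J n : ℕ) (hm : m ≠ 0) :
    apEstimate m K J n = (∑ k ∈ Finset.range K, 1 / ((m : ℝ) * k + 1)) +
      (Real.log (m * (K + n) + 1 : ℕ) - Real.log (m * K + 1 : ℕ)) / m +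
      ((m * (K + n) + 1 : ℕ) + (m * K + 1 : ℕ)) /
        (2 * (m * (K + n) + 1 : ℕ) * (m * K + 1 : ℕ)) +
      ∑ j ∈ Finset.range J, (bernoulli (2 * (j + 1)) : ℝ) * m ^ (2 * j + 1) *
        ((m * (K + n) + 1 : ℕ) ^ (2 * (j + 1)) - (m * K + 1 : ℕ) ^ (2 * (j + 1))) /
        (2 * (j + 1) * ((m * (K + n) + 1 : ℕ) * (m * K + 1 : ℕ)) ^ (2 * (j + 1))) := by
  have hm' : (m : ℝ) ≠ 0 := by exact_mod_cast hm
  have ha : (0 : ℝ) < (m * (K + n) + 1 : ℕ) := by positivity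
  have hc : (0 : ℝ) < (m * K + 1 : ℕ) := by positivity
  have ean : (m : ℝ) * n + (K * m + 1) = (m * (K + n) + 1 : ℕ) := by push_cast; ring
  have ec0 : (m : ℝ) * 0 + (K * m + 1) = (m * K + 1 : ℕ) := by push_cast; ring
  have hint : ∫ x in (0 : ℝ)..n, tailFun m K x =
      (Real.log (m * (K + n) + 1 : ℕ) - Real.log (m * K + 1 : ℕ)) / m := by
    have := intervalIntegral.integral_comp_mul_add (a := 0) (b := n) (fun x : ℝ => 1 / x) hm'
      ((K : ℝ) * m + 1)
    simp only [tailFun, add_assoc]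
    rw [this, ean, ec0, integral_one_div_of_pos hc ha, Real.log_div ha.ne' hc.ne', smul_eq_mul]
    ring
  have hterm : ∀ j, iteratedDeriv (2 * (j + 1) - 1) (tailFun m K) n -
      iteratedDeriv (2 * (j + 1) - 1) (tailFun m K) 0 = ((2 * j + 1)! : ℝ) * m ^ (2 * j + 1) *
        ((m * (K + n) + 1 : ℕ) ^ (2 * (j + 1)) - (m * K + 1 : ℕ) ^ (2 * (j + 1))) /
        (((m * (K + n) + 1 : ℕ) * (m * K + 1 : ℕ)) ^ (2 * (j + 1))) := by
    intro j
    rw [iteratedDeriv_tailFun', iteratedDeriv_tailFun', ean, ec0,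
      show 2 * (j + 1) - 1 = 2 * j + 1 by omega, show 2 * j + 1 + 1 = 2 * (j + 1) by ring,
      Odd.neg_one_pow ⟨j, rfl⟩, mul_pow]
    field_simp
    ring
  have hshift : ∀ F : ℕ → ℝ, ∑ j ∈ Finset.Icc 1 J, F j = ∑ j ∈ Finset.range J, F (j + 1) :=
    fun F => by rw [Finset.range_eq_Ico, Finset.sum_Ico_add' F 0 J 1]; rfl
  rw [apEstimate, eulerMaclaurinApprox, hint, hshift, add_assoc, add_assoc, add_assoc]
  congr 3
  · rw [tailFun, tailFun, add_assoc, add_assoc, ean, ec0]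
    field_simp
  · refine Finset.sum_congr rfl fun j _ => ?_
    rw [hterm, show 2 * (j + 1) = 2 * j + 1 + 1 by ring, Nat.factorial_succ]
    push_cast
    field_simp
    ring

lemma eulerMaclaurinBound_tailFun_zero (m K J n : ℕ) :
    eulerMaclaurinBound J (tailFun m K) n 0 =
      |(bernoulli (2 * J + 2) : ℝ)| * n * m ^ (2 * J + 2) / (m * K + 1 : ℕ) ^ (2 * J + 3) := by
  have ec0 : (m : ℝ) * 0 + (K * m + 1) = (m * K + 1 : ℕ) := by push_cast; ring
  rw [eulerMaclaurinBound, iteratedDeriv_tailFun', ec0]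
  simp only [abs_mul, abs_div, abs_pow, Nat.abs_cast, abs_neg, abs_one, one_pow, one_mul]
  have : ((2 * J + 2)! : ℝ) ≠ 0 := by positivity
  field_simp

/-- Fixed-point approximation of the Euler-Maclaurin correction terms; `l` is the list of the
integers `bernoulliDenom * B_i` for `i = N, ..., 0`. -/
def correctionApprox (m a c N : ℕ) (l : List ℤ) : ℕ → ℤ
  | 0 => 0
  | j + 1 => correctionApprox m a c N l j +
      fixedScale * (l.getD (N - 2 * (j + 1)) 0 * m ^ (2 * j + 1) *
        ((a : ℤ) ^ (2 * (j + 1)) - (c : ℤ) ^ (2 * (j + 1)))) /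
        (bernoulliDenom * (2 * (j + 1) * (a * c) ^ (2 * (j + 1))))

lemma bernoulliDenom_pos : 0 < bernoulliDenom := by
  rw [bernoulliDenom]
  norm_num

lemma fixedApprox_correction {m a c N : ℕ} {l : List ℤ} (ha : 0 < a) (hc : 0 < c)
    (hl : bernoulliList bernoulliDenom N = some l) {J : ℕ} (hJ : 2 * J ≤ N) :
    FixedApprox (∑ j ∈ Finset.range J, (bernoulli (2 * (j + 1)) : ℝ) * m ^ (2 * j + 1) *
        ((a : ℝ) ^ (2 * (j + 1)) - (c : ℝ) ^ (2 * (j + 1))) /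
        (2 * (j + 1) * ((a : ℝ) * c) ^ (2 * (j + 1)))) (correctionApprox m a c N l J) J := by
  have hD := bernoulliDenom_pos
  induction J with
  | zero => simp [FixedApprox, correctionApprox]
  | succ J ih =>
    rw [Finset.sum_range_succ, correctionApprox]
    push_cast
    refine (ih (by omega)).add ?_
    convert FixedApprox.ratio _ (q := bernoulliDenom * (2 * (J + 1) * (a * c) ^ (2 * (J + 1))))
      (by positivity) using 1
    push_cast
    rw [bernoulliList_getD hl hJ]
    have hD' : (bernoulliDenom : ℝ) ≠ 0 := by exact_mod_cast hD.ne'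
    field_simp

/-- Fixed-point approximation of `apEstimate m K J n`. -/
def estimateApprox (m K J n : ℕ) (l : List ℤ) (d e : ℕ) : ℤ :=
  reciprocalSum m K d 0 + logRatioApprox (m * (K + n) + 1) (m * K + 1) e / m +
    fixedScale * ((m * (K + n) + 1 : ℕ) + (m * K + 1 : ℕ)) /
      (2 * (m * (K + n) + 1 : ℕ) * (m * K + 1 : ℕ)) +
    correctionApprox m (m * (K + n) + 1) (m * K + 1) (2 * J + 2) l J

/-- The error of `estimateApprox`. -/
def estimateError (K J e : ℕ) : ℤ := K + (1592 * (e + 1) + 1) + 1 + J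

lemma fixedApprox_estimate {m K J n d e : ℕ} {l : List ℤ} (hm : m ≠ 0) (hd : K ≤ 2 ^ d)
    (h1 : (m * K + 1) * 2 ^ e ≤ m * (K + n) + 1) (h2 : m * (K + n) + 1 ≤ 2 * ((m * K + 1) * 2 ^ e))
    (hl : bernoulliList bernoulliDenom (2 * J + 2) = some l) :
    FixedApprox (apEstimate m K J n) (estimateApprox m K J n l d e) (estimateError K J e) := by
  rw [apEstimate_eq m K J n hm]
  refine FixedApprox.add (FixedApprox.add (FixedApprox.add ?_ ?_) ?_) ?_
  · exact fixedApprox_reciprocalSum hd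
  · exact (fixedApprox_logRatio (by positivity) h1 h2).div_int (q := m) (by omega)
  · convert FixedApprox.ratio _ (q := 2 * (m * (K + n) + 1 : ℕ) * (m * K + 1 : ℕ))
      (by positivity) using 1
    push_cast
    rfl
  · exact fixedApprox_correction (by positivity) (by positivity) hl (by omega)

/-- Fixed-point approximation of `eulerMaclaurinBound J (tailFun m K) n 0`. -/
def boundApprox (m K J n : ℕ) (l : List ℤ) : ℤ :=
  fixedScale * (|l.getD 0 0| * n * m ^ (2 * J + 2)) /
    (bernoulliDenom * (m * K + 1 : ℕ) ^ (2 * J + 3))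

lemma fixedApprox_bound {m K J n : ℕ} {l : List ℤ}
    (hl : bernoulliList bernoulliDenom (2 * J + 2) = some l) :
    FixedApprox (eulerMaclaurinBound J (tailFun m K) n 0) (boundApprox m K J n l) 1 := by
  have hD := bernoulliDenom_pos
  have hD' : (0 : ℝ) < bernoulliDenom := by exact_mod_cast hD
  have hB := bernoulliList_getD hl le_rfl
  rw [Nat.sub_self] at hB
  unfold boundApprox
  convert FixedApprox.ratio (|l.getD 0 0| * n * m ^ (2 * J + 2))
    (q := bernoulliDenom * (m * K + 1 : ℕ) ^ (2 * J + 3))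
    (by positivity) using 1
  rw [eulerMaclaurinBound_tailFun_zero]
  push_cast
  rw [hB, abs_mul, abs_of_pos hD']
  field_simp

/-- The certificate for given data, in fixed-point arithmetic. -/
def certificateCheck (m K J n : ℕ) (l : List ℤ) (d e : ℕ) : Bool :=
  decide (m ≠ 0) && decide (K ≤ 2 ^ d) && decide ((m * K + 1) * 2 ^ e ≤ m * (K + n) + 1) &&
    decide (m * (K + n) + 1 ≤ 2 * ((m * K + 1) * 2 ^ e)) &&
    decide (estimateApprox m K J n l d e + boundApprox m K J n l + (estimateError K J e + 1) <
      twoPiApprox - 31840) &&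
    decide (twoPiApprox + boundApprox m K J n l + (31840 + 1) <
      estimateApprox m K J n l d e + fixedScale * 1 / (m * (K + n + 1 : ℕ) + 1) -
        (estimateError K J e + 1))

lemma eulerMaclaurinCertifies_of_check {m K J n d e : ℕ} {l : List ℤ}
    (hl : bernoulliList bernoulliDenom (2 * J + 2) = some l)
    (h : certificateCheck m K J n l d e = true) : EulerMaclaurinCertifies m K J n := by
  simp only [certificateCheck, Bool.and_eq_true, decide_eq_true_eq] at h
  obtain ⟨⟨⟨⟨⟨hm, hd⟩, h1⟩, h2⟩, h3⟩, h4⟩ := h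
  have hest := fixedApprox_estimate hm hd h1 h2 hl
  have hbd := fixedApprox_bound (m := m) (K := K) (n := n) hl
  have hlast := FixedApprox.ratio 1 (q := m * (K + n + 1 : ℕ) + 1) (by positivity)
  refine eulerMaclaurinCertifies_of_bounds ((hest.add hbd).lt_of_lt fixedApprox_two_pi h3) ?_
  -- The remainder bound is moved to the side of `2π`, so only sums of approximations are compared.
  have := (fixedApprox_two_pi.add hbd).lt_of_lt (hest.add hlast) h4
  push_cast at this ⊢
  linarith

/-- The largest `e` with `c * 2 ^ e ≤ a`, if that is at most the first argument. -/
def ratioLog : ℕ → ℕ → ℕ → ℕ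
  | 0, _, _ => 0
  | fuel + 1, a, c => bif Nat.ble (2 * c) a then ratioLog fuel a (2 * c) + 1 else 0

/-- The certificate for a row of the table, in fixed-point arithmetic. -/
def rowCheck (r : TableRow) : Bool :=
  match bernoulliList bernoulliDenom (2 * r.J + 2) with
  | none => false
  -- `ratioLog 20 r.K 1 + 1` is meant as the bit length of `K`, giving `K ≤ 2 ^ d`. The fuels 20 and
  -- 1000 need no justification, since `certificateCheck` tests the resulting inequalities.
  | some l => decide (r.K ≤ r.M) && certificateCheck r.m r.K r.J (r.M - r.K) l (ratioLog 20 r.K 1 + 1)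
      (ratioLog 1000 (r.m * r.M + 1) (r.m * r.K + 1))

lemma exists_certificate_of_rowCheck {r : TableRow} (h : rowCheck r = true) :
    ∃ n : ℕ, r.M = r.K + n ∧ EulerMaclaurinCertifies r.m r.K r.J n := by
  rw [rowCheck] at h
  match hl : bernoulliList bernoulliDenom (2 * r.J + 2) with
  | none => simp [hl] at h
  | some l =>
    simp only [hl, Bool.and_eq_true, decide_eq_true_eq] at h
    exact ⟨r.M - r.K, by omega, eulerMaclaurinCertifies_of_check hl h.2⟩

/-- In the row `m = 100` the next term is about `6 * 10^(-232)`, while the accumulated rounding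
error is of the order of `10^6` units of `10^(-250)`. -/
lemma sincTable_rowCheck : sincTable.all rowCheck = true := by
  decide +kernel

/-! ### Riemann–Lebesgue, the sine integral and the sawtooth partial sums -/

-- The integral is minus the imaginary part of the Fourier transform of `f` cut off to `(0, u]`, at
-- frequency `w / (2π)`; the Riemann–Lebesgue lemma applies.
open MeasureTheory in
lemma tendsto_integral_sin_mul {f : ℝ → ℝ} {u : ℝ} (hu : 0 ≤ u)
    (hf : IntegrableOn f (Set.Ioc 0 u)) :
    Tendsto (fun w : ℝ => ∫ t in (0 : ℝ)..u, Real.sin (w * t) * f t) atTop (𝓝 0) := by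
  have hRL := (Real.tendsto_integral_exp_smul_cocompact
    ((Set.Ioc 0 u).indicator fun t => (f t : ℂ))).comp
    ((tendsto_id.atTop_div_const (by positivity : 0 < 2 * Real.pi)).mono_right
      atTop_le_cocompact)
  have him := (Complex.continuous_im.tendsto 0).comp hRL
  have := him.neg
  simp only [Complex.zero_im, neg_zero] at this
  refine this.congr fun w => ?_
  have hint : IntegrableOn (fun t => Real.fourierChar (-(t * (w / (2 * Real.pi)))) • (f t : ℂ))
      (Set.Ioc 0 u) := by
    simp only [Circle.smul_def, smul_eq_mul]
    refine (Integrable.ofReal (𝕜 := ℂ) hf).bdd_mul (c := 1) ?_ ?_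
    · exact Continuous.aestronglyMeasurable (by fun_prop)
    · exact Eventually.of_forall fun t => (Circle.norm_coe _).le
  simp only [Function.comp, id]
  have e : (fun v => Real.fourierChar (-(v * (w / (2 * Real.pi)))) •
      (Set.Ioc 0 u).indicator (fun t => (f t : ℂ)) v) = (Set.Ioc 0 u).indicator
      fun v => Real.fourierChar (-(v * (w / (2 * Real.pi)))) • (f v : ℂ) := by
    ext v
    by_cases hv : v ∈ Set.Ioc 0 u <;> simp [hv]
  rw [e, integral_indicator measurableSet_Ioc, intervalIntegral.integral_of_le hu]
  have := Complex.imCLM.integral_comp_comm hint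
  simp only [Complex.imCLM_apply] at this
  rw [← this, ← integral_neg]
  refine integral_congr_ae (Eventually.of_forall fun v => ?_)
  simp only [Circle.smul_def, Real.fourierChar_apply, smul_eq_mul, Complex.mul_im,
    Complex.ofReal_re, Complex.ofReal_im, mul_zero, zero_add, Complex.exp_ofReal_mul_I_im]
  rw [show 2 * Real.pi * -(v * (w / (2 * Real.pi))) = -(w * v) by field_simp, Real.sin_neg]
  ring

/-- The partial sums of the sine series of the sawtooth wave. -/
noncomputable def sawtoothSum (T : ℕ) (u : ℝ) : ℝ := ∑ n ∈ Finset.Icc 1 T, Real.sin (n * u) / n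

/-- The difference of `1 / (2 * sin (t / 2))` and `1 / t`. -/
noncomputable def cscDiff (t : ℝ) : ℝ := 1 / (2 * Real.sin (t / 2)) - 1 / t

/-- With `t = 2s` the difference is `(s - sin s)/(2 s sin s)`. From `s cos s ≤ sin s` the numerator
is at most `s (1 - cos s) ≤ s^3/2`, and `sin s ≥ s/2`, so the quotient is at most `s/2 ≤ 1`. -/
lemma abs_cscDiff_le {t : ℝ} (h0 : 0 < t) (h1 : t ≤ Real.pi) : |cscDiff t| ≤ 1 := by
  obtain ⟨s, rfl⟩ : ∃ s, t = 2 * s := ⟨t / 2, by ring⟩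
  have hs0 : 0 < s := by linarith
  have hs1 : s ≤ Real.pi / 2 := by linarith
  have hsin : 0 < Real.sin s := Real.sin_pos_of_pos_of_lt_pi hs0 (by linarith [Real.pi_pos])
  have h2 : 2 / Real.pi * s ≤ Real.sin s := Real.mul_le_sin hs0.le hs1
  have h3 : s * Real.cos s ≤ Real.sin s := by
    rcases eq_or_lt_of_le hs1 with h | h
    · rw [h, Real.cos_pi_div_two, mul_zero, Real.sin_pi_div_two]; norm_num
    · have hcos := Real.cos_pos_of_mem_Ioo ⟨by linarith, h⟩
      have := (Real.lt_tan hs0 h).le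
      rwa [Real.tan_eq_sin_div_cos, le_div_iff₀ hcos] at this
  have h4 := Real.one_sub_sq_div_two_le_cos (x := s)
  have h5 : Real.sin s ≤ s := (Real.sin_lt hs0).le
  have h6 : s - Real.sin s ≤ s ^ 3 / 2 := by nlinarith
  have h7 : s ≤ 2 * Real.sin s := by
    have : 1 / 2 ≤ 2 / Real.pi := by
      rw [div_le_div_iff₀ (by norm_num) Real.pi_pos]
      linarith [Real.pi_le_four]
    nlinarith
  have e : cscDiff (2 * s) = (s - Real.sin s) / (2 * s * Real.sin s) := by
    rw [cscDiff, mul_div_cancel_left₀ _ (by norm_num : (2 : ℝ) ≠ 0)]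
    field_simp
  rw [e, abs_of_nonneg (div_nonneg (by linarith) (by positivity)), div_le_one (by positivity)]
  have hs2 : s ≤ 2 := by linarith [Real.pi_le_four]
  have : s ^ 3 / 2 ≤ s * s := by nlinarith [mul_pos hs0 hs0]
  nlinarith

lemma measurable_cscDiff : Measurable cscDiff := by
  unfold cscDiff
  fun_prop

lemma sum_cos_mul_sin (T : ℕ) (t : ℝ) : 2 * Real.sin (t / 2) *
    ∑ n ∈ Finset.Icc 1 T, Real.cos (n * t) = Real.sin ((T + 1 / 2) * t) - Real.sin (t / 2) := by
  induction T with
  | zero => simp; ring_nf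
  | succ T ih =>
    rw [Finset.sum_Icc_succ_top (by omega), mul_add, ih]
    have h1 := Real.sin_add ((T + 1 : ℕ) * t) (t / 2)
    have h2 := Real.sin_sub ((T + 1 : ℕ) * t) (t / 2)
    rw [show ((T + 1 : ℕ) : ℝ) * t + t / 2 = ((T + 1 : ℕ) + 1 / 2) * t by ring] at h1
    rw [show ((T + 1 : ℕ) : ℝ) * t - t / 2 = (T + 1 / 2) * t by push_cast; ring] at h2
    linarith

/-- The sine integral. -/
noncomputable def sineIntegral (x : ℝ) : ℝ := ∫ t in (0 : ℝ)..x, Real.sinc t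

lemma integral_mul_sinc (u T : ℝ) :
    ∫ x in (0 : ℝ)..T, u * Real.sinc (u * x) = sineIntegral (u * T) := by
  rw [intervalIntegral.integral_const_mul, intervalIntegral.mul_integral_comp_mul_left, mul_zero]
  rfl

lemma integrableOn_cscDiff {u : ℝ} (hu : u ≤ Real.pi) :
    MeasureTheory.IntegrableOn cscDiff (Set.Ioc 0 u) := by
  refine MeasureTheory.Measure.integrableOn_of_bounded (M := 1) (by simp)
    measurable_cscDiff.aestronglyMeasurable ?_
  filter_upwards [MeasureTheory.ae_restrict_mem measurableSet_Ioc] with t ht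
  exact abs_cscDiff_le ht.1 (ht.2.trans hu)

/-- The derivative of the partial sum is the Dirichlet kernel `-1/2 + sin ((T+1/2) t) / (2 sin
(t/2))`. Splitting `1/(2 sin (t/2))` as `cscDiff t + 1/t` isolates the sine integral from a term
that Riemann–Lebesgue sends to zero. -/
lemma sawtoothSum_eq (T : ℕ) {u : ℝ} (h0 : 0 ≤ u) (h1 : u ≤ Real.pi) :
    sawtoothSum T u = -u / 2 + (∫ t in (0 : ℝ)..u, Real.sin ((T + 1 / 2) * t) * cscDiff t) +
      sineIntegral ((T + 1 / 2) * u) := by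
  have hderiv : ∀ x, HasDerivAt (sawtoothSum T) (∑ n ∈ Finset.Icc 1 T, Real.cos (n * x)) x := by
    intro x
    unfold sawtoothSum
    refine HasDerivAt.fun_sum fun n hn => ?_
    have hn' : (n : ℝ) ≠ 0 := by
      have := (Finset.mem_Icc.1 hn).1
      positivity
    have := (((hasDerivAt_id x).const_mul (n : ℝ)).sin).div_const (n : ℝ)
    refine this.congr_deriv ?_
    simp
    field_simp
  have hFTC : sawtoothSum T u = ∫ t in (0 : ℝ)..u, ∑ n ∈ Finset.Icc 1 T, Real.cos (n * t) := by
    rw [intervalIntegral.integral_eq_sub_of_hasDerivAt (fun x _ => hderiv x)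
      (Continuous.intervalIntegrable (by fun_prop) _ _)]
    simp [sawtoothSum]
  have hint : IntervalIntegrable (fun t => Real.sin ((T + 1 / 2) * t) * cscDiff t)
      MeasureTheory.volume 0 u := by
    rw [intervalIntegrable_iff_integrableOn_Ioc_of_le h0]
    refine (integrableOn_cscDiff h1).bdd_mul (c := 1) ?_ ?_
    · exact Continuous.aestronglyMeasurable (by fun_prop)
    · exact Eventually.of_forall fun t => Real.abs_sin_le_one _
  have hsinc := Real.continuous_sinc
  have hint2 : IntervalIntegrable (fun t => (T + 1 / 2) * Real.sinc ((T + 1 / 2) * t))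
      MeasureTheory.volume 0 u := Continuous.intervalIntegrable (by fun_prop) _ _
  have hconst : -u / 2 = ∫ t in (0 : ℝ)..u, (-1 / 2 : ℝ) := by
    simp [div_eq_mul_inv]
  rw [hFTC, ← integral_mul_sinc, hconst,
    ← intervalIntegral.integral_add (by simp) hint, ← intervalIntegral.integral_add
      (IntervalIntegrable.add (by simp) hint) hint2]
  refine intervalIntegral.integral_congr_ae (Eventually.of_forall fun t ht => ?_)
  rw [Set.uIoc_of_le h0] at ht
  have hsin : 0 < Real.sin (t / 2) :=
    Real.sin_pos_of_pos_of_lt_pi (by linarith [ht.1]) (by linarith [ht.2, Real.pi_pos])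
  have ht0 := ht.1
  have hne : ((T : ℝ) + 1 / 2) * t ≠ 0 := by positivity
  have hne' : (T : ℝ) + 1 / 2 ≠ 0 := by positivity
  have hsum : ∑ n ∈ Finset.Icc 1 T, Real.cos (n * t) =
      (Real.sin ((T + 1 / 2) * t) - Real.sin (t / 2)) / (2 * Real.sin (t / 2)) := by
    rw [eq_div_iff (by positivity), mul_comm, sum_cos_mul_sin]
  rw [hsum, Real.sinc_of_ne_zero hne, cscDiff]
  generalize Real.sin ((T + 1 / 2) * t) = σ
  field_simp
  ring

lemma tendsto_integral_sin_mul_cscDiff {u : ℝ} (h0 : 0 ≤ u) (h1 : u ≤ Real.pi) :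
    Tendsto (fun T : ℕ => ∫ t in (0 : ℝ)..u, Real.sin ((T + 1 / 2) * t) * cscDiff t) atTop
      (𝓝 0) :=
  (tendsto_integral_sin_mul h0 (integrableOn_cscDiff h1)).comp
    (tendsto_atTop_add_const_right _ _ tendsto_natCast_atTop_atTop)

lemma abs_integral_sin_mul_cscDiff_le (w : ℝ) {u : ℝ} (h0 : 0 ≤ u) (h1 : u ≤ Real.pi) :
    |∫ t in (0 : ℝ)..u, Real.sin (w * t) * cscDiff t| ≤ u := by
  have := intervalIntegral.norm_integral_le_of_norm_le_const (a := 0) (b := u) (C := 1)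
    (f := fun t => Real.sin (w * t) * cscDiff t) fun t ht => by
      rw [Set.uIoc_of_le h0] at ht
      rw [norm_mul]
      exact mul_le_one₀ (Real.abs_sin_le_one _) (norm_nonneg _)
        (abs_cscDiff_le ht.1 (ht.2.trans h1))
  simpa [abs_of_nonneg h0] using this

lemma intervalIntegrable_sinc (a b : ℝ) :
    IntervalIntegrable Real.sinc MeasureTheory.volume a b :=
  Real.continuous_sinc.intervalIntegrable _ _

/-- At `u = π` every `sin (nπ)` vanishes, so `sawtoothSum_eq` gives the limit `π/2` along the points
`(T + 1/2) π`. Other `x` are within `π` of such a point, and there `|sinc|` is at most `1/(Nπ)` with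
`N = ⌊x/π⌋`. -/
lemma tendsto_sineIntegral_atTop : Tendsto sineIntegral atTop (𝓝 (Real.pi / 2)) := by
  have hpi := Real.pi_pos
  have hseq : Tendsto (fun T : ℕ => sineIntegral ((T + 1 / 2) * Real.pi)) atTop
      (𝓝 (Real.pi / 2)) := by
    have h := (tendsto_integral_sin_mul_cscDiff hpi.le le_rfl).const_sub (Real.pi / 2)
    rw [sub_zero] at h
    refine h.congr fun T => ?_
    have := sawtoothSum_eq T hpi.le le_rfl
    have h0 : sawtoothSum T Real.pi = 0 := Finset.sum_eq_zero fun n _ => by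
      rw [Real.sin_nat_mul_pi, zero_div]
    linarith
  have hfloor : Tendsto (fun x : ℝ => ⌊x / Real.pi⌋₊) atTop atTop :=
    tendsto_nat_floor_atTop.comp (tendsto_id.atTop_div_const hpi)
  have hdiff : Tendsto (fun x : ℝ =>
      sineIntegral x - sineIntegral ((⌊x / Real.pi⌋₊ + 1 / 2) * Real.pi)) atTop (𝓝 0) := by
    refine squeeze_zero_norm' (a := fun x : ℝ => Real.pi * (⌊x / Real.pi⌋₊ * Real.pi)⁻¹) ?_ ?_
    · filter_upwards [eventually_ge_atTop Real.pi] with x hx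
      set N := ⌊x / Real.pi⌋₊
      have hN : (N : ℝ) * Real.pi ≤ x := by
        rw [← le_div_iff₀ hpi]
        exact Nat.floor_le (div_nonneg (hpi.le.trans hx) hpi.le)
      have hN1 : x ≤ (N + 1) * Real.pi := by
        rw [← div_le_iff₀ hpi]
        exact (Nat.lt_floor_add_one _).le
      have hNpos : 1 ≤ N := Nat.le_floor (by rw [Nat.cast_one]; rwa [one_le_div hpi])
      have hNpos' : (1 : ℝ) ≤ N := by exact_mod_cast hNpos
      rw [sineIntegral, sineIntegral, intervalIntegral.integral_interval_sub_left
        (intervalIntegrable_sinc _ _) (intervalIntegrable_sinc _ _)]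
      refine (intervalIntegral.norm_integral_le_of_norm_le_const (C := (N * Real.pi)⁻¹)
        fun t ht => ?_).trans ?_
      · have ht' : N * Real.pi ≤ t := by
          refine le_trans (le_min ?_ hN) (Set.mem_Ioc.1 ht).1.le
          nlinarith
        have : 0 < N * Real.pi := by positivity
        rw [Real.sinc_of_ne_zero (by linarith), norm_div, Real.norm_eq_abs, Real.norm_eq_abs,
          abs_of_pos (by linarith : 0 < t), ← one_div]
        gcongr
        exact Real.abs_sin_le_one _
      · rw [mul_comm]
        gcongr
        rw [abs_le]
        constructor <;> nlinarith
    · rw [← mul_zero Real.pi]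
      exact ((tendsto_natCast_atTop_atTop.comp hfloor).atTop_mul_const hpi).inv_tendsto_atTop.const_mul _
  have := hdiff.add (hseq.comp hfloor)
  rw [zero_add] at this
  refine this.congr fun x => ?_
  simp

lemma sineIntegral_neg (x : ℝ) : sineIntegral (-x) = -sineIntegral x := by
  have := intervalIntegral.integral_comp_neg (a := 0) (b := x) Real.sinc
  simp only [Real.sinc_neg, neg_zero] at this
  rw [sineIntegral, sineIntegral, this, ← intervalIntegral.integral_symm]

lemma continuous_sineIntegral : Continuous sineIntegral :=
  intervalIntegral.continuous_primitive (fun _ _ => intervalIntegrable_sinc _ _) 0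

lemma exists_abs_sineIntegral_le : ∃ C, ∀ x, |sineIntegral x| ≤ C := by
  have h1 := tendsto_sineIntegral_atTop.eventually (Metric.ball_mem_nhds _ one_pos)
  obtain ⟨X, hX⟩ := eventually_atTop.1 h1
  obtain ⟨C, hC⟩ := (isCompact_Icc (a := 0) (b := X)).exists_bound_of_continuousOn
    continuous_sineIntegral.continuousOn
  have hpos : ∀ x, 0 ≤ x → |sineIntegral x| ≤ max C (1 + Real.pi / 2) := by
    intro x hx
    rcases le_total x X with h | h
    · exact (hC x ⟨hx, h⟩).trans (le_max_left _ _)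
    · refine le_trans ?_ (le_max_right _ _)
      have := hX x h
      rw [Real.dist_eq, abs_lt] at this
      rw [abs_le]
      constructor <;> linarith [Real.pi_pos]
  refine ⟨max C (1 + Real.pi / 2), fun x => ?_⟩
  rcases le_total 0 x with h | h
  · exact hpos x h
  · have := hpos (-x) (by linarith)
    rwa [sineIntegral_neg, abs_neg] at this

lemma tendsto_sineIntegral_mul (u : ℝ) :
    Tendsto (fun T : ℝ => sineIntegral (u * T)) atTop (𝓝 (Real.pi / 2 * Real.sign u)) := by
  rcases lt_trichotomy u 0 with h | rfl | h
  · rw [Real.sign_of_neg h, mul_neg_one]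
    refine (tendsto_sineIntegral_atTop.comp
      (tendsto_id.const_mul_atTop (neg_pos.2 h))).neg.congr fun T => ?_
    simp [sineIntegral_neg]
  · simp [sineIntegral]
  · rw [Real.sign_of_pos h, mul_one]
    exact tendsto_sineIntegral_atTop.comp (tendsto_id.const_mul_atTop h)

/-! ### The sawtooth wave as a bounded pointwise limit -/

/-- The sawtooth wave `∑ sin (n * u) / n`. -/
noncomputable def sawtooth (u : ℝ) : ℝ :=
  Real.pi / 2 * (⌊u / (2 * Real.pi)⌋ + ⌈u / (2 * Real.pi)⌉) - u / 2

lemma sawtoothSum_neg (T : ℕ) (u : ℝ) : sawtoothSum T (-u) = -sawtoothSum T u := by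
  simp [sawtoothSum, neg_div]

lemma sawtooth_neg (u : ℝ) : sawtooth (-u) = -sawtooth u := by
  simp only [sawtooth, neg_div, Int.floor_neg, Int.ceil_neg]
  push_cast
  ring

lemma sawtoothSum_add (T : ℕ) (u : ℝ) (k : ℤ) :
    sawtoothSum T (u + k * (2 * Real.pi)) = sawtoothSum T u := by
  refine Finset.sum_congr rfl fun n _ => ?_
  have := Real.sin_add_int_mul_two_pi (n * u) (n * k)
  push_cast at this
  rw [← this]
  congr 2
  ring

lemma sawtooth_add (u : ℝ) (k : ℤ) : sawtooth (u + k * (2 * Real.pi)) = sawtooth u := by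
  have : (u + k * (2 * Real.pi)) / (2 * Real.pi) = u / (2 * Real.pi) + k := by
    field_simp
  simp only [sawtooth, this, Int.floor_add_intCast, Int.ceil_add_intCast]
  push_cast
  ring

lemma exists_eq_add_mul_two_pi (u : ℝ) :
    ∃ v : ℝ, ∃ k : ℤ, |v| ≤ Real.pi ∧ u = v + k * (2 * Real.pi) := by
  refine ⟨u - round (u / (2 * Real.pi)) * (2 * Real.pi), round (u / (2 * Real.pi)), ?_, by ring⟩
  have hpi := Real.two_pi_pos
  have := abs_sub_round (u / (2 * Real.pi))
  rw [show u - round (u / (2 * Real.pi)) * (2 * Real.pi) =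
    (u / (2 * Real.pi) - round (u / (2 * Real.pi))) * (2 * Real.pi) by field_simp, abs_mul,
    abs_of_pos hpi]
  nlinarith

/-- Oddness and `2π`-periodicity reduce to `[0, π]`. Adding floor and ceiling gives the midpoint
value 0 at multiples of `2π`, where every partial sum vanishes. -/
lemma tendsto_sawtoothSum (u : ℝ) :
    Tendsto (fun T => sawtoothSum T u) atTop (𝓝 (sawtooth u)) := by
  have hpi := Real.pi_pos
  have hpos : ∀ v, 0 ≤ v → v ≤ Real.pi →
      Tendsto (fun T => sawtoothSum T v) atTop (𝓝 (sawtooth v)) := by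
    intro v h0 h1
    rcases h0.eq_or_lt with rfl | h0'
    · simp [sawtoothSum, sawtooth]
    have hS : sawtooth v = -v / 2 + 0 + Real.pi / 2 := by
      have hf : ⌊v / (2 * Real.pi)⌋ = 0 := by
        rw [Int.floor_eq_zero_iff]
        exact ⟨by positivity, by rw [div_lt_one (by positivity)]; linarith⟩
      have hc : ⌈v / (2 * Real.pi)⌉ = 1 := by
        rw [Int.ceil_eq_iff]
        constructor
        · simp; positivity
        · rw [Int.cast_one, div_le_one (by positivity)]; linarith
      rw [sawtooth, hf, hc]
      push_cast
      ring
    rw [hS]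
    have hSi : Tendsto (fun T : ℕ => sineIntegral ((T + 1 / 2) * v)) atTop (𝓝 (Real.pi / 2)) :=
      tendsto_sineIntegral_atTop.comp
        ((tendsto_atTop_add_const_right _ _ tendsto_natCast_atTop_atTop).atTop_mul_const h0')
    exact (((tendsto_integral_sin_mul_cscDiff h0 h1).const_add (-v / 2)).add hSi).congr fun T =>
      (sawtoothSum_eq T h0 h1).symm
  obtain ⟨v, k, hv, rfl⟩ := exists_eq_add_mul_two_pi u
  simp only [sawtoothSum_add, sawtooth_add]
  rw [abs_le] at hv
  rcases le_total 0 v with h | h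
  · exact hpos v h hv.2
  · have := (hpos (-v) (by linarith) (by linarith)).neg
    simpa only [sawtoothSum_neg, sawtooth_neg, neg_neg] using this

/-- Uniformity in both `T` and `u` provides the dominating constant for the passage to the limit
under the expectation. -/
lemma exists_abs_sawtoothSum_le : ∃ C, ∀ T u, |sawtoothSum T u| ≤ C := by
  obtain ⟨C, hC⟩ := exists_abs_sineIntegral_le
  have hpos : ∀ T v, 0 ≤ v → v ≤ Real.pi → |sawtoothSum T v| ≤ 2 * Real.pi + C := by
    intro T v h0 h1
    rw [sawtoothSum_eq T h0 h1]
    have h2 := abs_le.1 (abs_integral_sin_mul_cscDiff_le (T + 1 / 2) h0 h1)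
    have h3 := abs_le.1 (hC ((T + 1 / 2) * v))
    rw [abs_le]
    constructor <;> linarith
  refine ⟨2 * Real.pi + C, fun T u => ?_⟩
  obtain ⟨v, k, hv, rfl⟩ := exists_eq_add_mul_two_pi u
  rw [sawtoothSum_add]
  rw [abs_le] at hv
  rcases le_total 0 v with h | h
  · exact hpos T v h hv.2
  · have := hpos T (-v) (by linarith) (by linarith)
    rwa [sawtoothSum_neg, abs_neg] at this

/-! ### Sums of independent uniform variables -/

section UniformSum

open MeasureTheory ProbabilityTheory

/-- The uniform distribution on `[-a, a]`. -/
noncomputable def uniformSymm (a : ℝ) : Measure ℝ := volume[|Set.Icc (-a) a]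

/-- The law of `∑_{k < N} U_k`, where the `U_k` are independent and uniform on `[-b k, b k]`. -/
noncomputable def uniformSumLaw (b : ℕ → ℝ) : ℕ → Measure ℝ
  | 0 => Measure.dirac 0
  | N + 1 => uniformSumLaw b N ∗ uniformSymm (b N)

lemma volume_Icc_neg_self_ne_zero {a : ℝ} (ha : 0 < a) : volume (Set.Icc (-a) a) ≠ 0 := by
  rw [Real.volume_Icc]
  simp [ha]

lemma isProbabilityMeasure_uniformSymm {a : ℝ} (ha : 0 < a) :
    IsProbabilityMeasure (uniformSymm a) :=
  cond_isProbabilityMeasure_of_finite (volume_Icc_neg_self_ne_zero ha) (by simp)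

lemma isProbabilityMeasure_uniformSumLaw {b : ℕ → ℝ} (hb : ∀ k, 0 < b k) (N : ℕ) :
    IsProbabilityMeasure (uniformSumLaw b N) := by
  induction N with
  | zero => rw [uniformSumLaw]; infer_instance
  | succ N ih =>
    have := isProbabilityMeasure_uniformSymm (hb N)
    rw [uniformSumLaw]
    infer_instance

lemma charFun_uniformSymm {a : ℝ} (ha : 0 < a) (x : ℝ) :
    charFun (uniformSymm a) x = Real.sinc (a * x) := by
  rw [charFun_apply_real, uniformSymm, ProbabilityTheory.cond, integral_smul_measure, integral_Icc_eq_integral_Ioc,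
    ← intervalIntegral.integral_of_le (by linarith), Real.volume_Icc]
  have hR : (ENNReal.ofReal (a - -a))⁻¹.toReal = (2 * a)⁻¹ := by
    rw [ENNReal.toReal_inv, ENNReal.toReal_ofReal (by linarith)]
    ring_nf
  rw [hR]
  rcases eq_or_ne x 0 with rfl | hx
  · have : (a : ℂ) ≠ 0 := by exact_mod_cast ha.ne'
    simp
    field_simp
    norm_num
  · have h1 := intervalIntegral.integral_comp_mul_left (a := -a) (b := a)
      (fun t : ℝ => Complex.exp (t * Complex.I)) hx
    have h2 := integral_exp_mul_I_eq_sinc (x * a)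
    rw [show -(x * a) = x * -a by ring] at h2
    rw [h2] at h1
    push_cast at h1
    rw [h1, mul_comm x a]
    rw [Complex.real_smul, Complex.real_smul]
    have : (a : ℂ) ≠ 0 := by exact_mod_cast ha.ne'
    have : (x : ℂ) ≠ 0 := by exact_mod_cast hx
    push_cast
    field_simp

lemma charFun_uniformSumLaw {b : ℕ → ℝ} (hb : ∀ k, 0 < b k) (N : ℕ) (x : ℝ) :
    charFun (uniformSumLaw b N) x = ((∏ k ∈ Finset.range N, Real.sinc (b k * x) : ℝ) : ℂ) := by
  induction N with
  | zero => simp [uniformSumLaw, charFun_dirac]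
  | succ N ih =>
    have := isProbabilityMeasure_uniformSymm (hb N)
    have := isProbabilityMeasure_uniformSumLaw hb N
    rw [uniformSumLaw, charFun_conv, ih, charFun_uniformSymm (hb N), Finset.prod_range_succ]
    push_cast
    rfl

lemma integral_cos_uniformSumLaw {b : ℕ → ℝ} (hb : ∀ k, 0 < b k) (N : ℕ) (x : ℝ) :
    ∫ t, Real.cos (x * t) ∂(uniformSumLaw b N) = ∏ k ∈ Finset.range N, Real.sinc (b k * x) := by
  have := isProbabilityMeasure_uniformSumLaw hb N
  have h := congrArg Complex.re (charFun_uniformSumLaw hb N x)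
  rw [Complex.ofReal_re, charFun_apply_real] at h
  have hint : Integrable (fun t : ℝ => Complex.exp (x * t * Complex.I)) (uniformSumLaw b N) := by
    refine Integrable.of_bound (C := 1) (Continuous.aestronglyMeasurable (by fun_prop)) ?_
    refine Eventually.of_forall fun t => ?_
    rw [← Complex.ofReal_mul, Complex.norm_exp_ofReal_mul_I]
  have h2 := Complex.reCLM.integral_comp_comm hint
  simp only [Complex.reCLM_apply] at h2
  rw [← h, ← h2]
  refine integral_congr_ae (Eventually.of_forall fun t => ?_)
  simp only
  rw [← Complex.ofReal_mul, Complex.exp_ofReal_mul_I_re]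

lemma ae_abs_le_uniformSumLaw {b : ℕ → ℝ} (hb : ∀ k, 0 < b k) (N : ℕ) :
    ∀ᵐ t ∂(uniformSumLaw b N), |t| ≤ ∑ k ∈ Finset.range N, b k := by
  induction N with
  | zero => simp [uniformSumLaw, ae_dirac_eq]
  | succ N ih =>
    have := isProbabilityMeasure_uniformSymm (hb N)
    have := isProbabilityMeasure_uniformSumLaw hb N
    have hU : ∀ᵐ t ∂(uniformSymm (b N)), |t| ≤ b N := by
      filter_upwards [ae_cond_mem (μ := volume) measurableSet_Icc] with t ht
      exact abs_le.2 ht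
    rw [uniformSumLaw, Measure.conv, ae_map_iff (by fun_prop)
      (measurableSet_le (by fun_prop) (by fun_prop))]
    filter_upwards [Measure.quasiMeasurePreserving_fst.ae ih,
      Measure.quasiMeasurePreserving_snd.ae hU] with p h1 h2
    rw [Finset.sum_range_succ]
    exact (abs_add_le _ _).trans (add_le_add h1 h2)

lemma uniformSymm_ball_pos {a x ε : ℝ} (ha : 0 < a) (hx : |x| ≤ a) (hε : 0 < ε) :
    0 < uniformSymm a (Metric.ball x ε) := by
  rw [uniformSymm, cond_apply measurableSet_Icc]
  refine ENNReal.mul_pos (ENNReal.inv_ne_zero.2 (by simp)) (ne_of_gt ?_)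
  rw [abs_le] at hx
  have hlt : max (-a) (x - ε) < min a (x + ε) := by
    simp only [max_lt_iff, lt_min_iff]
    refine ⟨⟨?_, ?_⟩, ?_, ?_⟩ <;> linarith
  refine lt_of_lt_of_le ?_ (measure_mono (μ := volume)
    (s := Set.Ioo (max (-a) (x - ε)) (min a (x + ε))) ?_)
  · rw [Real.volume_Ioo]
    simpa using hlt
  · intro t ht
    simp only [Set.mem_Ioo, max_lt_iff, lt_min_iff] at ht
    rw [Real.ball_eq_Ioo]
    exact ⟨⟨ht.1.1.le, ht.2.1.le⟩, ht.1.2, ht.2.2⟩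

/-- Full support: the target `x` is split between the first `N` variables and the last in proportion
to `s` and `b N`, so each share is attainable, and each is then hit within `ε/2`. -/
lemma uniformSumLaw_ball_pos {b : ℕ → ℝ} (hb : ∀ k, 0 < b k) (N : ℕ) : ∀ {x ε : ℝ},
    |x| ≤ ∑ k ∈ Finset.range N, b k → 0 < ε → 0 < uniformSumLaw b N (Metric.ball x ε) := by
  induction N with
  | zero =>
    intro x ε hx hε
    obtain rfl : x = 0 := by simpa using hx
    simp [uniformSumLaw, hε]
  | succ N ih =>
    intro x ε hx hε
    have := isProbabilityMeasure_uniformSymm (hb N)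
    have := isProbabilityMeasure_uniformSumLaw hb N
    have hs : 0 ≤ ∑ k ∈ Finset.range N, b k := Finset.sum_nonneg fun k _ => (hb k).le
    rw [Finset.sum_range_succ] at hx
    set s := ∑ k ∈ Finset.range N, b k
    have hbN := hb N
    have hsN : 0 < s + b N := by linarith
    have hq : |x / (s + b N)| ≤ 1 := by
      rw [abs_div, abs_of_pos hsN, div_le_one hsN]
      exact hx
    have h1 := ih (x := x / (s + b N) * s) (ε := ε / 2)
      (by rw [abs_mul, abs_of_nonneg hs]; exact mul_le_of_le_one_left hs hq) (half_pos hε)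
    have h2 := uniformSymm_ball_pos (x := x / (s + b N) * b N) (ε := ε / 2) hbN
      (by rw [abs_mul, abs_of_pos hbN]; exact mul_le_of_le_one_left hbN.le hq) (half_pos hε)
    rw [uniformSumLaw, Measure.conv, Measure.map_apply (by fun_prop) measurableSet_ball]
    refine lt_of_lt_of_le (ENNReal.mul_pos h1.ne' h2.ne') ?_
    rw [← Measure.prod_prod]
    refine measure_mono fun p hp => ?_
    simp only [Set.mem_prod, Metric.mem_ball, Real.dist_eq, Set.mem_preimage] at hp ⊢
    have hxx : x = x / (s + b N) * s + x / (s + b N) * b N := by field_simp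
    calc |p.1 + p.2 - x| = |(p.1 - x / (s + b N) * s) + (p.2 - x / (s + b N) * b N)| := by
          congr 1
          linarith
      _ < ε := (abs_add_le _ _).trans_lt (by linarith [hp.1, hp.2])

/-! ### The aliasing discrepancy between series and integral -/

/-- The part of `sawtooth` and of the limits of `∫ sin (u * x) / x` that does not cancel. -/
noncomputable def aliasTerm (u : ℝ) : ℝ :=
  Real.pi / 2 * (⌊u / (2 * Real.pi)⌋ + ⌈u / (2 * Real.pi)⌉ - Real.sign u)

lemma aliasTerm_eq (u : ℝ) :
    aliasTerm u = sawtooth u + u / 2 - Real.pi / 2 * Real.sign u := by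
  rw [aliasTerm, sawtooth]
  ring

lemma aliasTerm_eq_zero {u : ℝ} (hu : |u| < 2 * Real.pi) : aliasTerm u = 0 := by
  have hpi := Real.two_pi_pos
  rw [abs_lt] at hu
  have h1 : u / (2 * Real.pi) < 1 := by rw [div_lt_one hpi]; exact hu.2
  have h2 : -1 < u / (2 * Real.pi) := by rw [lt_div_iff₀ hpi]; linarith
  rw [aliasTerm]
  rcases lt_trichotomy u 0 with h | rfl | h
  · have h3 : u / (2 * Real.pi) < 0 := div_neg_of_neg_of_pos h hpi
    have hf : ⌊u / (2 * Real.pi)⌋ = -1 := by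
      rw [Int.floor_eq_iff]; constructor <;> push_cast <;> linarith
    have hc : ⌈u / (2 * Real.pi)⌉ = 0 := by
      rw [Int.ceil_eq_iff]; constructor <;> push_cast <;> linarith
    rw [hf, hc, Real.sign_of_neg h]
    norm_num
  · simp
  · have h3 : 0 < u / (2 * Real.pi) := by positivity
    have hf : ⌊u / (2 * Real.pi)⌋ = 0 := by
      rw [Int.floor_eq_iff]; constructor <;> push_cast <;> linarith
    have hc : ⌈u / (2 * Real.pi)⌉ = 1 := by
      rw [Int.ceil_eq_iff]; constructor <;> push_cast <;> linarith
    rw [hf, hc, Real.sign_of_pos h]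
    norm_num

lemma aliasTerm_nonneg {u : ℝ} (hu : 0 < u) : 0 ≤ aliasTerm u := by
  have hpi := Real.pi_pos
  have h3 : 0 < u / (2 * Real.pi) := by positivity
  have hf : (0 : ℝ) ≤ ⌊u / (2 * Real.pi)⌋ := by exact_mod_cast Int.floor_nonneg.2 h3.le
  have hc : (1 : ℝ) ≤ ⌈u / (2 * Real.pi)⌉ := by exact_mod_cast Int.ceil_pos.2 h3
  rw [aliasTerm, Real.sign_of_pos hu]
  exact mul_nonneg (by positivity) (by linarith)

lemma aliasTerm_neg (u : ℝ) : aliasTerm (-u) = -aliasTerm u := by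
  rw [aliasTerm_eq, aliasTerm_eq, sawtooth_neg, Real.sign_neg]
  ring

/-- On either side of zero the sign is constant and floor plus ceiling is monotone; across zero,
`aliasTerm` passes from nonpositive to nonnegative values. -/
lemma aliasTerm_mono : Monotone aliasTerm := by
  have hpi := Real.pi_pos
  intro u v huv
  have hq : u / (2 * Real.pi) ≤ v / (2 * Real.pi) := by gcongr
  have hf : (⌊u / (2 * Real.pi)⌋ : ℝ) ≤ ⌊v / (2 * Real.pi)⌋ := by exact_mod_cast Int.floor_mono hq
  have hc : (⌈u / (2 * Real.pi)⌉ : ℝ) ≤ ⌈v / (2 * Real.pi)⌉ := by exact_mod_cast Int.ceil_mono hq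
  have hnonpos : ∀ w, w ≤ 0 → aliasTerm w ≤ 0 := fun w hw => by
    rcases hw.eq_or_lt with rfl | h
    · rw [aliasTerm_eq_zero (by simpa using hpi)]
    · have := aliasTerm_nonneg (neg_pos.2 h)
      rw [aliasTerm_neg] at this
      linarith
  have hnonneg : ∀ w, 0 ≤ w → 0 ≤ aliasTerm w := fun w hw => by
    have := hnonpos (-w) (by linarith)
    rw [aliasTerm_neg] at this
    linarith
  rcases le_or_gt u 0 with h | h
  · rcases le_or_gt 0 v with h' | h'
    · exact (hnonpos u h).trans (hnonneg v h')
    · rw [aliasTerm, aliasTerm, Real.sign_of_neg h', Real.sign_of_neg (huv.trans_lt h')]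
      gcongr
  · rw [aliasTerm, aliasTerm, Real.sign_of_pos h, Real.sign_of_pos (h.trans_le huv)]
    gcongr

lemma aliasTerm_pos {u : ℝ} (hu : 2 * Real.pi < u) : 0 < aliasTerm u := by
  have hpi := Real.pi_pos
  have h1 : 1 < u / (2 * Real.pi) := by rwa [one_lt_div (by positivity)]
  have hf : (1 : ℝ) ≤ ⌊u / (2 * Real.pi)⌋ := by
    exact_mod_cast Int.le_floor.2 (by exact_mod_cast h1.le)
  have hc : (1 : ℝ) ≤ ⌈u / (2 * Real.pi)⌉ := by
    exact_mod_cast Int.one_le_ceil_iff.2 (by linarith)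
  rw [aliasTerm, Real.sign_of_pos (by linarith)]
  exact mul_pos (by positivity) (by linarith)

lemma exists_abs_sawtooth_le : ∃ C, ∀ u, |sawtooth u| ≤ C := by
  obtain ⟨C, hC⟩ := exists_abs_sawtoothSum_le
  exact ⟨C, fun u => le_of_tendsto (tendsto_sawtoothSum u).abs (Eventually.of_forall fun T => hC T u)⟩

lemma measurable_sawtooth : Measurable sawtooth := by
  unfold sawtooth
  fun_prop

lemma measurable_realSign : Measurable Real.sign := by
  unfold Real.sign
  exact Measurable.ite measurableSet_Iio measurable_const
    (Measurable.ite measurableSet_Ioi measurable_const measurable_const)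

lemma abs_realSign_le (u : ℝ) : |Real.sign u| ≤ 1 := by
  rcases Real.sign_apply_eq u with h | h | h <;> simp [h]

lemma sinc_mul_prod_sinc_eq_integral {b : ℕ → ℝ} (hb : ∀ k, 0 < b k) (N : ℕ)
    (x : ℝ) :
    Real.sinc x * ∏ k ∈ Finset.range N, Real.sinc (b k * x) =
      ∫ t, Real.sinc x * Real.cos (x * t) ∂(uniformSumLaw b N) := by
  rw [integral_const_mul, integral_cos_uniformSumLaw hb]

lemma integrable_sawtooth_sub {b : ℕ → ℝ} (hb : ∀ k, 0 < b k) (N : ℕ) :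
    Integrable (fun t => (sawtooth (t + 1) - sawtooth (t + -1)) / 2) (uniformSumLaw b N) := by
  have := isProbabilityMeasure_uniformSumLaw hb N
  obtain ⟨C, hC⟩ := exists_abs_sawtooth_le
  have h : ∀ c, Integrable (fun t => sawtooth (t + c)) (uniformSumLaw b N) := fun c =>
    Integrable.of_bound (C := C)
      (measurable_sawtooth.comp (measurable_id.add_const c)).aestronglyMeasurable
      (Eventually.of_forall fun t => hC _)
  exact ((h 1).sub (h (-1))).div_const 2

lemma integrable_realSign_sub {b : ℕ → ℝ} (hb : ∀ k, 0 < b k) (N : ℕ) :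
    Integrable (fun t => (Real.pi / 2 * Real.sign (t + 1) - Real.pi / 2 * Real.sign (t + -1)) / 2)
      (uniformSumLaw b N) := by
  have := isProbabilityMeasure_uniformSumLaw hb N
  have h : ∀ c, Integrable (fun t => Real.sign (t + c)) (uniformSumLaw b N) := fun c =>
    Integrable.of_bound (C := 1)
      (measurable_realSign.comp (measurable_id.add_const c)).aestronglyMeasurable
      (Eventually.of_forall fun t => abs_realSign_le _)
  exact (((h 1).const_mul _).sub ((h (-1)).const_mul _)).div_const 2

/-- For fixed `t` the sum of `sinc n * cos (n t)` is half the difference of sawtooth partial sums at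
`t + 1` and `t - 1`; dominated convergence then gives the limit of the expectations. -/
lemma tendsto_sum_sinc_prod {b : ℕ → ℝ} (hb : ∀ k, 0 < b k) (N : ℕ) :
    Tendsto (fun T : ℕ => ∑ n ∈ Finset.Icc 1 T,
      Real.sinc n * ∏ k ∈ Finset.range N, Real.sinc (b k * n)) atTop
      (𝓝 (∫ t, (sawtooth (t + 1) - sawtooth (t + -1)) / 2 ∂(uniformSumLaw b N))) := by
  have := isProbabilityMeasure_uniformSumLaw hb N
  obtain ⟨C, hC⟩ := exists_abs_sawtoothSum_le
  have hmeas : ∀ T : ℕ, Continuous fun t => (sawtoothSum T (t + 1) - sawtoothSum T (t + -1)) / 2 := by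
    intro T
    unfold sawtoothSum
    fun_prop
  have hlim := tendsto_integral_of_dominated_convergence (μ := uniformSumLaw b N)
    (F := fun (T : ℕ) t => (sawtoothSum T (t + 1) - sawtoothSum T (t + -1)) / 2)
    (f := fun t => (sawtooth (t + 1) - sawtooth (t + -1)) / 2) (fun _ => C)
    (fun T => (hmeas T).aestronglyMeasurable) (integrable_const _)
    (fun T => Eventually.of_forall fun t => by
      rw [Real.norm_eq_abs]
      have h1 := abs_le.1 (hC T (t + 1))
      have h2 := abs_le.1 (hC T (t + -1))
      rw [abs_le]
      constructor <;> linarith)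
    (Eventually.of_forall fun t =>
      ((tendsto_sawtoothSum (t + 1)).sub (tendsto_sawtoothSum (t + -1))).div_const 2)
  refine hlim.congr fun T => ?_
  have hint : ∀ n ∈ Finset.Icc 1 T, Integrable (fun t => Real.sinc n * Real.cos (n * t))
      (uniformSumLaw b N) := fun n _ =>
    Integrable.of_bound (C := 1) (Continuous.aestronglyMeasurable (by fun_prop))
      (Eventually.of_forall fun t => by
        rw [norm_mul]
        exact mul_le_one₀ (Real.abs_sinc_le_one _) (norm_nonneg _) (Real.abs_cos_le_one _))
  simp_rw [sinc_mul_prod_sinc_eq_integral hb N]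
  rw [← integral_finsetSum _ hint]
  refine integral_congr_ae (Eventually.of_forall fun t => ?_)
  simp only [sawtoothSum]
  rw [← Finset.sum_sub_distrib, Finset.sum_div]
  refine Finset.sum_congr rfl fun n hn => ?_
  have hn0 : (n : ℝ) ≠ 0 := by
    have := (Finset.mem_Icc.1 hn).1
    positivity
  rw [Real.sinc_of_ne_zero hn0, mul_add, mul_add, mul_one, mul_neg_one, Real.sin_add, Real.sin_add,
    Real.sin_neg, Real.cos_neg]
  ring

lemma intervalIntegral_sinc_mul_cos (T t : ℝ) :
    ∫ x in (0 : ℝ)..T, Real.sinc x * Real.cos (x * t) =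
      (sineIntegral ((t + 1) * T) - sineIntegral ((t + -1) * T)) / 2 := by
  have hsinc := Real.continuous_sinc
  rw [← integral_mul_sinc, ← integral_mul_sinc, ← intervalIntegral.integral_sub
    (Continuous.intervalIntegrable (by fun_prop) _ _)
    (Continuous.intervalIntegrable (by fun_prop) _ _), ← intervalIntegral.integral_div]
  refine intervalIntegral.integral_congr fun x _ => ?_
  have hs : ∀ c y : ℝ, y ≠ 0 → c * Real.sinc (c * y) = Real.sin (c * y) / y := fun c y hy => by
    rcases eq_or_ne c 0 with rfl | hc
    · simp
    · rw [Real.sinc_of_ne_zero (mul_ne_zero hc hy)]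
      field_simp
  rcases eq_or_ne x 0 with rfl | hx
  · simp
  · rw [hs _ _ hx, hs _ _ hx, Real.sinc_of_ne_zero hx, add_mul, add_mul, one_mul, neg_one_mul,
      Real.sin_add, Real.sin_add, Real.sin_neg, Real.cos_neg, mul_comm t x]
    ring

/-- Fubini on the finite interval exchanges integral and expectation before `T → ∞`; this avoids
integrability on the half-line, which fails for `N = 0`. -/
lemma tendsto_integral_sinc_prod {b : ℕ → ℝ} (hb : ∀ k, 0 < b k) (N : ℕ) :
    Tendsto (fun T : ℝ => ∫ x in (0 : ℝ)..T,
      Real.sinc x * ∏ k ∈ Finset.range N, Real.sinc (b k * x)) atTop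
      (𝓝 (∫ t, (Real.pi / 2 * Real.sign (t + 1) - Real.pi / 2 * Real.sign (t + -1)) / 2
        ∂(uniformSumLaw b N))) := by
  have := isProbabilityMeasure_uniformSumLaw hb N
  obtain ⟨C, hC⟩ := exists_abs_sineIntegral_le
  have hcont := continuous_sineIntegral
  have hsinc := Real.continuous_sinc
  have hlim := tendsto_integral_filter_of_dominated_convergence (μ := uniformSumLaw b N)
    (l := atTop)
    (F := fun (T : ℝ) t => (sineIntegral ((t + 1) * T) - sineIntegral ((t + -1) * T)) / 2)
    (f := fun t => (Real.pi / 2 * Real.sign (t + 1) - Real.pi / 2 * Real.sign (t + -1)) / 2)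
    (fun _ => C)
    (Eventually.of_forall fun T => Continuous.aestronglyMeasurable (by fun_prop))
    (Eventually.of_forall fun T => Eventually.of_forall fun t => by
      rw [Real.norm_eq_abs]
      have h1 := abs_le.1 (hC ((t + 1) * T))
      have h2 := abs_le.1 (hC ((t + -1) * T))
      rw [abs_le]
      constructor <;> linarith)
    (integrable_const _)
    (Eventually.of_forall fun t =>
      ((tendsto_sineIntegral_mul (t + 1)).sub (tendsto_sineIntegral_mul (t + -1))).div_const 2)
  refine hlim.congr fun T => ?_
  simp_rw [sinc_mul_prod_sinc_eq_integral hb N]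
  rw [intervalIntegral_integral_swap]
  · simp_rw [intervalIntegral_sinc_mul_cos]
  · have : IsFiniteMeasure (volume.restrict (Set.uIoc 0 T)) :=
      ⟨by rw [Measure.restrict_apply_univ, Set.uIoc, Real.volume_Ioc]; exact ENNReal.ofReal_lt_top⟩
    refine Integrable.of_bound (C := 1) (Continuous.aestronglyMeasurable ?_)
      (Eventually.of_forall fun p => ?_)
    · unfold Function.uncurry
      fun_prop
    · rw [Function.uncurry, norm_mul]
      exact mul_le_one₀ (Real.abs_sinc_le_one _) (norm_nonneg _) (Real.abs_cos_le_one _)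

/-- The term `u/2` in `aliasTerm_eq` contributes `((t+1) - (t-1))/4 = 1/2`, which is the constant in
front of the series. -/
lemma half_add_sum_sub_integral {b : ℕ → ℝ} (hb : ∀ k, 0 < b k) (N : ℕ) :
    1 / 2 + (∫ t, (sawtooth (t + 1) - sawtooth (t + -1)) / 2 ∂(uniformSumLaw b N)) -
      (∫ t, (Real.pi / 2 * Real.sign (t + 1) - Real.pi / 2 * Real.sign (t + -1)) / 2
        ∂(uniformSumLaw b N)) =
      ∫ t, (aliasTerm (t + 1) - aliasTerm (t + -1)) / 2 ∂(uniformSumLaw b N) := by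
  have := isProbabilityMeasure_uniformSumLaw hb N
  have h1 := integrable_sawtooth_sub hb N
  have h2 := integrable_realSign_sub hb N
  have hhalf : (1 / 2 : ℝ) = ∫ _, (1 / 2 : ℝ) ∂(uniformSumLaw b N) := by simp
  rw [hhalf, ← integral_add (integrable_const _) h1,
    ← integral_sub (f := fun t => 1 / 2 + (sawtooth (t + 1) - sawtooth (t + -1)) / 2)
      ((integrable_const _).add h1) h2]
  refine integral_congr_ae (Eventually.of_forall fun t => ?_)
  simp only [aliasTerm_eq]
  ring

lemma integrable_aliasTerm {b : ℕ → ℝ} (hb : ∀ k, 0 < b k) (N : ℕ) :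
    Integrable (fun t => (aliasTerm (t + 1) - aliasTerm (t + -1)) / 2) (uniformSumLaw b N) := by
  have := isProbabilityMeasure_uniformSumLaw hb N
  have h1 := integrable_sawtooth_sub hb N
  have h2 := integrable_realSign_sub hb N
  refine (((integrable_const (1 / 2 : ℝ)).add h1).sub h2).congr (Eventually.of_forall fun t => ?_)
  simp only [aliasTerm_eq, Pi.add_apply, Pi.sub_apply]
  ring

lemma integral_aliasTerm_eq_zero {b : ℕ → ℝ} (hb : ∀ k, 0 < b k) (N : ℕ)
    (hs : 1 + ∑ k ∈ Finset.range N, b k < 2 * Real.pi) :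
    ∫ t, (aliasTerm (t + 1) - aliasTerm (t + -1)) / 2 ∂(uniformSumLaw b N) = 0 := by
  refine integral_eq_zero_of_ae ?_
  filter_upwards [ae_abs_le_uniformSumLaw hb N] with t ht
  have h1 : |t + 1| < 2 * Real.pi := (abs_add_le _ _).trans_lt (by rw [abs_one]; linarith)
  have h2 : |t + -1| < 2 * Real.pi :=
    (abs_add_le _ _).trans_lt (by rw [abs_neg, abs_one]; linarith)
  rw [aliasTerm_eq_zero h1, aliasTerm_eq_zero h2]
  simp

lemma integral_aliasTerm_pos {b : ℕ → ℝ} (hb : ∀ k, 0 < b k) (N : ℕ)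
    (hs : 2 * Real.pi < 1 + ∑ k ∈ Finset.range N, b k) :
    0 < ∫ t, (aliasTerm (t + 1) - aliasTerm (t + -1)) / 2 ∂(uniformSumLaw b N) := by
  have hpi := Real.pi_gt_three
  rw [integral_pos_iff_support_of_nonneg _ (integrable_aliasTerm hb N)]
  · set s := ∑ k ∈ Finset.range N, b k
    -- Near such an `x` one has `t + 1 > 2π` and `|t - 1| < 2π`, so the first alias term is positive
    -- and the second zero; `x < s` keeps the ball in reach of the law.
    obtain ⟨x, hx1, hx2⟩ := exists_between (show 2 * Real.pi - 1 < min s (2 * Real.pi + 1) by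
      rw [lt_min_iff]; constructor <;> linarith)
    rw [lt_min_iff] at hx2
    obtain ⟨ε, hε, hball⟩ := Metric.isOpen_iff.1
      (isOpen_Ioo (a := 2 * Real.pi - 1) (b := 2 * Real.pi + 1)) x ⟨hx1, hx2.2⟩
    refine (uniformSumLaw_ball_pos hb N (x := x) (ε := ε) ?_ hε).trans_le (measure_mono fun t ht => ?_)
    · rw [abs_of_nonneg (by linarith)]
      exact hx2.1.le
    · have ht' := hball ht
      have h1 := aliasTerm_pos (u := t + 1) (by linarith [ht'.1])
      have h2 := aliasTerm_eq_zero (u := t + -1) (by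
        rw [abs_lt]; constructor <;> linarith [ht'.1, ht'.2])
      rw [Function.mem_support, h2, sub_zero]
      positivity
  · intro t
    have := aliasTerm_mono (show t + -1 ≤ t + 1 by linarith)
    simp only [Pi.zero_apply]
    linarith

end UniformSum

/-! ### Assembly of the theorem -/

lemma sincProd_eq {a : ℕ → ℝ} (h0 : a 0 = 1) (N : ℕ) (x : ℝ) :
    sincProd a N x = Real.sinc x * ∏ k ∈ Finset.range N, Real.sinc (a (k + 1) * x) := by
  rw [sincProd, Finset.prod_range_succ', h0, one_mul, mul_comm]

lemma exists_sinc_sum_integral {a : ℕ → ℝ} (h0 : a 0 = 1) (ha : ∀ k, 0 < a k) (N : ℕ) :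
    ∃ S I : ℝ, SincSeriesConverges a N S ∧ SincIntegralConverges a N I ∧
      (∑ k ∈ Finset.range (N + 1), a k < 2 * Real.pi → 1 / 2 + S = I) ∧
      (2 * Real.pi < ∑ k ∈ Finset.range (N + 1), a k → I < 1 / 2 + S) := by
  have hb : ∀ k, 0 < a (k + 1) := fun k => ha _
  have hsum : ∑ k ∈ Finset.range (N + 1), a k = 1 + ∑ k ∈ Finset.range N, a (k + 1) := by
    rw [Finset.sum_range_succ', h0, add_comm]
  have hdiff := half_add_sum_sub_integral hb N
  have hS : SincSeriesConverges a N _ :=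
    (tendsto_sum_sinc_prod hb N).congr fun T => by simp_rw [sincProd_eq h0]
  have hI : SincIntegralConverges a N _ :=
    (tendsto_integral_sinc_prod hb N).congr fun T => by simp_rw [sincProd_eq h0]
  rw [hsum]
  exact ⟨_, _, hS, hI, fun h => by linarith [integral_aliasTerm_eq_zero hb N h],
    fun h => by linarith [integral_aliasTerm_pos hb N h]⟩

theorem mainTheorem1 (r : TableRow) (hr : r ∈ sincTable) :
    IsGreatest {M : ℕ | apSum r.m M < 2 * Real.pi} r.M ∧
    (∃ n : ℕ, r.M = r.K + n ∧ EulerMaclaurinCertifies r.m r.K r.J n) ∧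
    ∀ N : ℕ, ∃ S I : ℝ,
      SincSeriesConverges (fun k => 1 / ((r.m : ℝ) * k + 1)) N S ∧
      SincIntegralConverges (fun k => 1 / ((r.m : ℝ) * k + 1)) N I ∧
      (1 / 2 + S = I ↔ N ≤ r.M) := by
  obtain ⟨n, hn, hcert⟩ := exists_certificate_of_rowCheck (List.all_eq_true.1 sincTable_rowCheck r hr)
  have hlt : apSum r.m r.M < 2 * Real.pi := hn ▸ hcert.apSum_lt
  -- Monotonicity carries the strict inequality at `M + 1` to all larger `N`, which settles both the
  -- maximality of `M` and the failure of equality.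
  have hgt : ∀ N, r.M < N → 2 * Real.pi < apSum r.m N := fun N hN =>
    hcert.lt_apSum.trans_le (apSum_mono r.m (by omega))
  refine ⟨⟨hlt, fun N hN => ?_⟩, ⟨n, hn, hcert⟩, fun N => ?_⟩
  · by_contra h
    exact lt_asymm (hgt N (not_le.1 h)) hN
  · obtain ⟨S, I, hS, hI, heq, hne⟩ := exists_sinc_sum_integral
      (a := fun k : ℕ => 1 / ((r.m : ℝ) * k + 1)) (by simp) (fun k => by positivity) N
    refine ⟨S, I, hS, hI, fun h => ?_, fun h => heq ((apSum_mono r.m h).trans_lt hlt)⟩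
    by_contra hN
    exact (hne (hgt N (not_le.1 hN))).ne' h
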